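/- Let $n\ge 2$ be an integer. For a finite graph $H=(V,E)$ with at least one edge, a set $A\subseteq\mathbb R^n$ is a unit-copy of $H$ if there is a bijection $f:V\to A$ with $\|f(u)-f(v)\|=1$ (Euclidean norm) whenever $uv\in E$; it is an induced unit-copy if $f$ can be chosen so that moreover $\|f(u)-f(v)\|\ne 1$ whenever $uv\notin E$. Let $\chi_H(\mathbb R^n)$ (respectively $\chi_H^{\mathrm{ind}}(\mathbb R^n)$) be the smallest $r\in\mathbb N$ such that there is a coloring of $\mathbb R^n$ with $r$ colors and no monochromatic unit-copy (respectively, no monochromatic induced unit-copy) of $H$. Let $\chi(\mathbb R^n)$ be the smallest $r\in\mathbb N$ such that there is a coloring of $\mathbb R^n$ with $r$ colors in which no two points at distance $1$ have the same color. Let $C_m$ denote the cycle with $m$ vertices. Then $\chi(\mathbb R^n)$ is finite and the following hold. 1. $\chi_F^{\mathrm{ind}}(\mathbb R^n)=\chi_F(\mathbb R^n)=\chi(\mathbb R^n)$ for every finite forest $F$ with at least one edge. 2. $\chi_{C_{2\ell}}^{\mathrm{ind}}(\mathbb R^n)=\chi_{C_{2\ell}}(\mathbb R^n)=\chi(\mathbb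 R^n)$ for $\ell=4$ and for every integer $\ell\ge 6$. 3. There exists $\ell_0=\ell_0(n)$ such that $\chi_{C_{2\ell+1}}(\mathbb R^n)=\lceil\chi(\mathbb R^n)/2\rceil$ for every integer $\ell\ge\ell_0$. -/

import Mathlib

/-- The set `A ⊆ ℝⁿ` is a unit-copy of the graph `H`: there is a bijection `f` from the vertices
of `H` onto `A` such that adjacent vertices go to points at Euclidean distance one. -/
def IsUnitCopy {n : ℕ} {V : Type*} (H : SimpleGraph V)
    (A : Set (EuclideanSpace ℝ (Fin n))) : Prop :=
  ∃ f : V → EuclideanSpace ℝ (Fin n), Function.Injective f ∧ Set.range f = A ∧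
    ∀ u v, H.Adj u v → dist (f u) (f v) = 1

/-- The set `A ⊆ ℝⁿ` is an induced unit-copy of the graph `H`: there is a bijection `f` from the
vertices of `H` onto `A` such that two vertices are adjacent if and only if their images are at
Euclidean distance one. -/
def IsInducedUnitCopy {n : ℕ} {V : Type*} (H : SimpleGraph V)
    (A : Set (EuclideanSpace ℝ (Fin n))) : Prop :=
  ∃ f : V → EuclideanSpace ℝ (Fin n), Function.Injective f ∧ Set.range f = A ∧
    ∀ u v, H.Adj u v ↔ dist (f u) (f v) = 1

/-- The set `A` is monochromatic under the coloring `c`. -/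
def IsMonochromatic {X C : Type*} (c : X → C) (A : Set X) : Prop :=
  ∃ k : C, ∀ x ∈ A, c x = k

/-- The least `r ∈ ℕ` such that some coloring of `ℝⁿ` with `r` colors has no monochromatic
unit-copy of `H` (and `⊤` if there is no such `r`). -/
noncomputable def chiGraph {V : Type*} (n : ℕ) (H : SimpleGraph V) : ℕ∞ :=
  ⨅ r ∈ {r : ℕ | ∃ c : EuclideanSpace ℝ (Fin n) → Fin r,
    ∀ A, IsUnitCopy H A → ¬ IsMonochromatic c A}, (r : ℕ∞)

/-- The least `r ∈ ℕ` such that some coloring of `ℝⁿ` with `r` colors has no monochromatic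
induced unit-copy of `H` (and `⊤` if there is no such `r`). -/
noncomputable def chiGraphInd {V : Type*} (n : ℕ) (H : SimpleGraph V) : ℕ∞ :=
  ⨅ r ∈ {r : ℕ | ∃ c : EuclideanSpace ℝ (Fin n) → Fin r,
    ∀ A, IsInducedUnitCopy H A → ¬ IsMonochromatic c A}, (r : ℕ∞)

/-- The unit-distance graph on all of `ℝⁿ`. -/
def unitDistanceGraph (n : ℕ) : SimpleGraph (EuclideanSpace ℝ (Fin n)) where
  Adj x y := dist x y = 1
  symm := ⟨fun x y h => by rw [dist_comm]; exact h⟩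
  loopless := ⟨fun x h => by simp at h⟩

/-- The chromatic number `χ(ℝⁿ)` of the space: the least number of colors in a coloring of `ℝⁿ`
in which no two points at distance one have the same color. -/
noncomputable def chiSpace (n : ℕ) : ℕ∞ := (unitDistanceGraph n).chromaticNumber

/-! The upper bounds are direct. A proper coloring with `k` colors has no monochromatic unit
distance, and merging its colors in pairs leaves classes whose unit-distance graphs are bipartite,
hence without odd cycles.

For the lower bounds, suppose `r < k` colors are used. By compactness some finite `V ⊆ ℝⁿ` is not
`r`-colorable, so every isometric copy of `V` has a monochromatic unit pair. Map words over `V` of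
length `N` to `ℝⁿ` by `w ↦ ∑ R i (w i)` with generic linear isometries `R i`: the map is injective,
distance one occurs only between words differing in a single letter, and varying one letter traces
an isometric copy of `V` (`exists_generic_word_map`). Choosing one unit pair in each coordinate
gives an `N`-dimensional cube whose unit distances are exactly its edges. Averaging over the choices
(`exists_dense_selection`, `exists_dense_unit_cube`) gives one for which a proportion of the edges,
bounded below independently of `N`, is monochromatic in one common color.

It remains to find the graph in a dense set of cube edges. Forests embed greedily in a subset of
large minimum degree, because two cube vertices have at most two common neighbors. For `C_{2l}`, an
Erdős-type count of triples yields a complete tripartite pattern between two levels of the cube, in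
which a suitable closed path in a three-dimensional grid becomes an induced cycle. Copies need be
induced only in the whole cube: color belongs to vertices, so it suffices that each vertex lies on a
selected edge.

For odd cycles, let `2 * r < k` and take `V` not `2r`-colorable. In each copy of `V` some color
class is not bipartite, so it has an edge whose ends are also joined by a monochromatic path of even
length. The selected edges share the color and the length of this path; replacing one edge of an
even cube cycle by its path makes the length odd. -/

/-! ### Generic linear isometries -/

theorem exists_forall_ne_zero_of_quadratic {n : ℕ} {κ : Type*} (s : Finset κ)
    (q : κ → MvPolynomial (Fin n) ℝ) (hq : ∀ k ∈ s, ∃ x, MvPolynomial.eval x (q k) ≠ 0) :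
    ∃ x, ∀ k ∈ s, MvPolynomial.eval x (q k) ≠ 0 := by
  have hprod : ∏ k ∈ s, q k ≠ 0 := by
    refine Finset.prod_ne_zero_iff.2 fun k hk h0 => ?_
    obtain ⟨x, hx⟩ := hq k hk
    exact hx (by rw [h0, map_zero])
  by_contra! hcon
  refine hprod (MvPolynomial.funext fun x => ?_)
  obtain ⟨k, hk, h⟩ := hcon x
  rw [map_prod, map_zero]
  exact Finset.prod_eq_zero hk h

theorem inner_eq_coord_sum {n : ℕ} (x y : EuclideanSpace ℝ (Fin n)) :
    inner ℝ x y = ∑ i, x i * y i := by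
  simp [PiLp.inner_apply, mul_comm]

/-- If this quadratic form in `v` vanished identically, a nonzero `v ⊥ w`, which exists since `n ≥
2`, would force `c = 0`; the remaining product of two nonzero linear forms cannot vanish at all of
`w`, `z` and `w + z`. -/
theorem exists_inner_mul_inner_ne {n : ℕ} (hn : 2 ≤ n) {z w : EuclideanSpace ℝ (Fin n)}
    (hz : z ≠ 0) (hw : w ≠ 0) (c : ℝ) :
    ∃ v : EuclideanSpace ℝ (Fin n), c * ‖v‖ ^ 2 - 2 * inner ℝ v w * inner ℝ v z ≠ 0 := by
  by_contra! h
  have hc : c = 0 := by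
    have hr : Module.finrank ℝ (ℝ ∙ w) < Module.finrank ℝ (EuclideanSpace ℝ (Fin n)) := by
      rw [finrank_span_singleton hw, finrank_euclideanSpace_fin]; omega
    have hne : (ℝ ∙ w)ᗮ ≠ ⊥ := by
      intro hb
      rw [Submodule.orthogonal_eq_bot_iff] at hb
      rw [hb, finrank_top] at hr
      exact lt_irrefl _ hr
    obtain ⟨v, hv, hv0⟩ := Submodule.exists_mem_ne_zero_of_ne_bot hne
    have h1 : inner ℝ v w = 0 := by
      rw [real_inner_comm]; exact Submodule.mem_orthogonal_singleton_iff_inner_right.1 hv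
    have := h v
    rw [h1] at this
    simpa [hv0] using this
  subst hc
  have hw' := h w
  have hz' := h z
  have hs := h (w + z)
  have nw : inner ℝ w w ≠ 0 := by simpa using hw
  have nz : inner ℝ z z ≠ 0 := by simpa using hz
  simp only [zero_mul, zero_sub, neg_eq_zero, mul_eq_zero, inner_add_left] at hw' hz' hs
  have e1 : inner ℝ w z = 0 := by
    rcases hw' with (h' | h') | h'
    · norm_num at h'
    · exact absurd h' nw
    · exact h'
  have e2 : inner ℝ z w = 0 := by rw [real_inner_comm]; exact e1
  rw [e1, e2] at hs
  simp at hs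
  exact hs.elim hw hz

/-- The isometry is the reflection in a line `ℝ ∙ v`. Each forbidden equation is polynomial in `v`
and not identically satisfied, so some `v` avoids all of the finitely many equations. -/
theorem exists_isometry_norm_ne {n : ℕ} (hn : 2 ≤ n) (Z W : Set (EuclideanSpace ℝ (Fin n)))
    (hZ : Z.Finite) (hW : W.Finite) :
    ∃ R : EuclideanSpace ℝ (Fin n) ≃ₗᵢ[ℝ] EuclideanSpace ℝ (Fin n),
      ∀ z ∈ Z, ∀ w ∈ W, z ≠ 0 → w ≠ 0 → z + R w ≠ 0 ∧ ‖z + R w‖ ≠ 1 := by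
  classical
  let E := EuclideanSpace ℝ (Fin n)
  let s : Finset (E × E × ℝ) :=
    ((hZ.toFinset.filter (· ≠ 0)) ×ˢ (hW.toFinset.filter (· ≠ 0)) ×ˢ {0, 1})
  -- For `R w = 2 (⟨v, w⟩ / ‖v‖²) v - w`, this is the equation `‖z + R w‖² = κ` multiplied by `-‖v‖²
  -- / 2`; the values `κ = 0, 1` are the ones to avoid.
  let q : E × E × ℝ → MvPolynomial (Fin n) ℝ := fun p =>
    MvPolynomial.C (inner ℝ p.1 p.2.1 - (‖p.1‖ ^ 2 + ‖p.2.1‖ ^ 2 - p.2.2) / 2) *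
        (∑ i, MvPolynomial.X i * MvPolynomial.X i) -
      2 * (∑ i, MvPolynomial.X i * MvPolynomial.C (p.2.1 i)) *
        (∑ i, MvPolynomial.X i * MvPolynomial.C (p.1 i))
  have heval : ∀ (v : E) (p : E × E × ℝ), MvPolynomial.eval (fun i => v i) (q p) =
      (inner ℝ p.1 p.2.1 - (‖p.1‖ ^ 2 + ‖p.2.1‖ ^ 2 - p.2.2) / 2) * ‖v‖ ^ 2 -
        2 * inner ℝ v p.2.1 * inner ℝ v p.1 := by
    intro v p
    simp only [q, map_sub, map_mul, map_sum, MvPolynomial.eval_C, MvPolynomial.eval_X,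
      ← inner_eq_coord_sum, real_inner_self_eq_norm_sq]
    norm_num
  obtain ⟨x, hx⟩ := exists_forall_ne_zero_of_quadratic s q (by
    rintro ⟨z, w, κ⟩ hp
    simp only [s, Finset.mem_product, Finset.mem_filter] at hp
    obtain ⟨v, hv⟩ := exists_inner_mul_inner_ne hn hp.1.2 hp.2.1.2
      (inner ℝ z w - (‖z‖ ^ 2 + ‖w‖ ^ 2 - κ) / 2)
    exact ⟨fun i => v i, by rw [heval]; exact hv⟩)
  let v : E := WithLp.toLp 2 x
  refine ⟨(ℝ ∙ v).reflection, fun z hz w hw hz0 hw0 => ?_⟩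
  have key : ∀ κ ∈ ({0, 1} : Finset ℝ), ‖z + (ℝ ∙ v).reflection w‖ ^ 2 ≠ κ := by
    intro κ hκ heq
    have h1 : (z, w, κ) ∈ s := by
      simp only [s, Finset.mem_product, Finset.mem_filter, Set.Finite.mem_toFinset]
      exact ⟨⟨hz, hz0⟩, ⟨hw, hw0⟩, hκ⟩
    have h2 := hx _ h1
    have h3 := heval v (z, w, κ)
    change MvPolynomial.eval x _ = _ at h3
    rw [h3] at h2
    have hv : v ≠ 0 := by
      intro h0
      apply h2
      rw [h0]; simp
    have hv2 : ‖v‖ ^ 2 ≠ 0 := pow_ne_zero 2 (norm_ne_zero_iff.2 hv)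
    apply h2
    rw [norm_add_sq_real, LinearIsometryEquiv.norm_map, Submodule.reflection_singleton_apply] at heq
    simp only [inner_sub_right, inner_smul_right, RCLike.ofReal_real_eq_id, id, two_smul,
      inner_add_right] at heq
    rw [real_inner_comm v z] at heq
    have hdiv : inner ℝ v w / ‖v‖ ^ 2 * ‖v‖ ^ 2 = inner ℝ v w := div_mul_cancel₀ _ hv2
    linear_combination (-(‖v‖ ^ 2) / 2) * heq + 2 * inner ℝ v z * hdiv
  constructor
  · intro h0
    exact key 0 (by simp) (by rw [h0]; simp)
  · intro h0
    exact key 1 (by simp) (by rw [h0]; simp)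

/-- The isometries are chosen one at a time, each generic with respect to the finite set of sums
already formed. A single nonzero letter may contribute norm one; two or more may not. -/
theorem exists_generic_isometries {n : ℕ} (hn : 2 ≤ n) (W : Set (EuclideanSpace ℝ (Fin n)))
    (hW : W.Finite) (N : ℕ) :
    ∃ R : Fin N → EuclideanSpace ℝ (Fin n) ≃ₗᵢ[ℝ] EuclideanSpace ℝ (Fin n),
      ∀ w : Fin N → EuclideanSpace ℝ (Fin n), (∀ i, w i ∈ W) →
        (w ≠ 0 → ∑ i, R i (w i) ≠ 0) ∧
        ∀ i j, i ≠ j → w i ≠ 0 → w j ≠ 0 → ‖∑ i, R i (w i)‖ ≠ 1 := by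
  induction N with
  | zero =>
    exact ⟨fun _ => .refl ℝ _, fun w _ => ⟨fun h => absurd (Subsingleton.elim w 0) h,
      fun i => i.elim0⟩⟩
  | succ N ih =>
    obtain ⟨R, hR⟩ := ih
    let Z : Set (EuclideanSpace ℝ (Fin n)) :=
      (fun w : Fin N → EuclideanSpace ℝ (Fin n) => ∑ i, R i (w i)) '' Set.univ.pi fun _ => W
    have hZ : Z.Finite := (Set.Finite.pi' fun _ => hW).subset (by
      intro x hx; exact fun i => hx i trivial) |>.image _
    obtain ⟨R₀, hR₀⟩ := exists_isometry_norm_ne hn Z W hZ hW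
    refine ⟨Fin.cons R₀ R, fun w hw => ?_⟩
    have hsum : ∑ i, (Fin.cons R₀ R : Fin (N + 1) → _) i (w i) =
        ∑ i, R i (w i.succ) + R₀ (w 0) := by
      rw [Fin.sum_univ_succ, add_comm]; simp
    rw [hsum]
    have hz : ∑ i, R i (w i.succ) ∈ Z := ⟨fun i => w i.succ, fun i _ => hw _, rfl⟩
    obtain ⟨h1, h2⟩ := hR (fun i => w i.succ) fun i => hw _
    by_cases h0 : w 0 = 0
    · rw [h0, map_zero, add_zero]
      refine ⟨fun hne => h1 fun h => hne ?_, fun i j hij hi hj => ?_⟩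
      · funext i
        refine Fin.cases h0 (fun i => congrFun h i) i
      · obtain ⟨i, rfl⟩ := Fin.exists_succ_eq_of_ne_zero (x := i) fun h => hi (h ▸ h0)
        obtain ⟨j, rfl⟩ := Fin.exists_succ_eq_of_ne_zero (x := j) fun h => hj (h ▸ h0)
        exact h2 i j (fun h => hij (h ▸ rfl)) hi hj
    · by_cases ht : (fun i : Fin N => w i.succ) = 0
      · have hs : ∑ i, R i (w i.succ) = 0 :=
          Finset.sum_eq_zero fun i _ => by rw [show w i.succ = 0 from congrFun ht i, map_zero]
        rw [hs, zero_add]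
        refine ⟨fun _ => by simpa using h0, fun i j hij hi hj => ?_⟩
        exfalso
        have : ∀ k, w k ≠ 0 → k = 0 := fun k hk => by
          by_contra hk0
          obtain ⟨k, rfl⟩ := Fin.exists_succ_eq_of_ne_zero hk0
          exact hk (congrFun ht k)
        exact hij ((this i hi).trans (this j hj).symm)
      · obtain ⟨h3, h4⟩ := hR₀ _ hz _ (hw 0) (h1 ht) h0
        exact ⟨fun _ => h3, fun _ _ _ _ _ => h4⟩

/-! ### Compactness, and finiteness of the chromatic number of space -/

theorem exists_finite_not_colorable {V : Type*} (G : SimpleGraph V) (r : ℕ) (h : ¬ G.Colorable r) :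
    ∃ S : Finset V, ¬ (G.induce (S : Set V)).Colorable r := by
  by_contra! hS
  refine h (SimpleGraph.nonempty_hom_of_forall_finite_subgraph_hom fun G' hG' => ?_)
  have hc := hS hG'.toFinset
  rw [hG'.coe_toFinset] at hc
  have hom : G'.coe →g G.induce G'.verts := ⟨id, fun h => G'.adj_sub h⟩
  exact (Classical.choice hc).comp hom

/-- Points are colored by their cell of side `1 / (n + 1)`, modulo `n + 2` in each coordinate. At
distance one the cell indices differ by less than `n + 2`, so equal colors mean the same cell, whose
squared diameter is at most `n / (n + 1)² < 1`. -/
theorem unitDistanceGraph_colorable (n : ℕ) : ∃ r, (unitDistanceGraph n).Colorable r := by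
  let M := n + 2
  let f : EuclideanSpace ℝ (Fin n) → Fin n → ZMod M := fun x i => (⌊((n : ℝ) + 1) * x i⌋ : ℤ)
  refine ⟨Fintype.card (Fin n → ZMod M), ?_⟩
  refine SimpleGraph.Coloring.colorable (α := Fin n → ZMod M) ⟨f, fun {x y} hxy heq => ?_⟩
  change dist x y = 1 at hxy
  have hn : (0 : ℝ) < (n : ℝ) + 1 := by positivity
  have hcoord : ∀ i, |x i - y i| ≤ 1 := fun i => by
    rw [← hxy, ← Real.dist_eq]
    have := PiLp.dist_apply_le x y i
    exact this
  have hfloor : ∀ i, ⌊((n : ℝ) + 1) * x i⌋ = ⌊((n : ℝ) + 1) * y i⌋ := by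
    intro i
    have h1 := congrFun heq i
    simp only [f] at h1
    rw [ZMod.intCast_eq_intCast_iff_dvd_sub] at h1
    obtain ⟨k, hk⟩ := h1
    have h2 := abs_le.1 (hcoord i)
    have hx1 := Int.floor_le (((n : ℝ) + 1) * x i)
    have hx2 := Int.lt_floor_add_one (((n : ℝ) + 1) * x i)
    have hy1 := Int.floor_le (((n : ℝ) + 1) * y i)
    have hy2 := Int.lt_floor_add_one (((n : ℝ) + 1) * y i)
    have hkR : ((⌊((n : ℝ) + 1) * y i⌋ : ℝ) - ⌊((n : ℝ) + 1) * x i⌋) = ((n : ℝ) + 2) * k := by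
      have := congrArg (Int.cast : ℤ → ℝ) hk
      push_cast [M] at this
      exact this
    have hk1 : (k : ℝ) < 1 := by nlinarith
    have hk2 : (-1 : ℝ) < k := by nlinarith
    have hk0 : k = 0 := by
      have a : k < 1 := by exact_mod_cast hk1
      have b : -1 < k := by exact_mod_cast hk2
      omega
    rw [hk0] at hk
    simp at hk
    linarith
  have hlt : ∀ i, (x i - y i) ^ 2 ≤ (1 / ((n : ℝ) + 1)) ^ 2 := by
    intro i
    have h1 := Int.abs_sub_lt_one_of_floor_eq_floor (hfloor i)
    rw [← mul_sub, abs_mul, abs_of_pos hn] at h1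
    rw [← sq_abs (x i - y i)]
    have : |x i - y i| ≤ 1 / ((n : ℝ) + 1) := by
      rw [le_div_iff₀ hn]; linarith
    gcongr
  have hd : dist x y ^ 2 = ∑ i, (x i - y i) ^ 2 := by
    rw [EuclideanSpace.dist_eq, Real.sq_sqrt (by positivity)]
    simp [Real.dist_eq]
  have hle : ∑ i, (x i - y i) ^ 2 ≤ n * (1 / ((n : ℝ) + 1)) ^ 2 := by
    refine (Finset.sum_le_sum fun i _ => hlt i).trans ?_
    simp
  rw [← hd, hxy, div_pow, mul_div_assoc', le_div_iff₀ (by positivity)] at hle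
  nlinarith

theorem chiSpace_eq_natCast (n : ℕ) : ∃ k : ℕ, chiSpace n = k ∧
    (unitDistanceGraph n).Colorable k ∧ ∀ r < k, ¬ (unitDistanceGraph n).Colorable r := by
  obtain ⟨r, hr⟩ := unitDistanceGraph_colorable n
  have hne := SimpleGraph.chromaticNumber_ne_top_iff_exists.2 ⟨r, hr⟩
  obtain ⟨k, hk⟩ := ENat.ne_top_iff_exists.1 hne
  refine ⟨k, hk.symm, SimpleGraph.chromaticNumber_le_iff_colorable.1 hk.ge, fun s hs hc => ?_⟩
  have := SimpleGraph.chromaticNumber_le_iff_colorable.2 hc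
  rw [← hk] at this
  exact absurd (by exact_mod_cast this) (not_le.2 hs)

/-! ### Counting: complete tripartite patterns in dense sets of cube edges -/

open scoped Classical in
theorem le_card_embeddings {Y : Type*} [Fintype Y] (P : Y → Prop) (t : ℕ) :
    (Finset.univ.filter P).card.descFactorial t ≤
      (Finset.univ.filter fun e : Fin t ↪ Y => ∀ j, P (e j)).card := by
  have h : Fintype.card (Fin t ↪ {y // P y}) = (Finset.univ.filter P).card.descFactorial t := by
    rw [Fintype.card_embedding_eq, Fintype.card_fin, Fintype.card_subtype]
  rw [← h, ← Finset.card_univ]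
  refine Finset.card_le_card_of_injOn (fun e => e.trans (Function.Embedding.subtype _)) ?_ ?_
  · intro e _
    simp only [Finset.coe_filter, Finset.mem_univ, true_and, Set.mem_ofPred_eq]
    exact fun j => (e j).2
  · intro e _ e' _ h
    ext j
    exact DFunLike.congr_fun h j

-- This is the convexity step of Kővári–Sós–Turán: the power mean inequality bounds the number of
-- `t`-tuples of neighbors from below in terms of the average degree.
open scoped Classical in
theorem le_sum_card_embeddings {X Y : Type*} [Fintype X] [Fintype Y] (S : X → Y → Prop) (t : ℕ)
    {ε : ℝ} (hε : 0 < ε) (hY : 2 * t ≤ ε * Fintype.card Y)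
    (hS : ε * Fintype.card X * Fintype.card Y ≤ ∑ x, ((Finset.univ.filter (S x)).card : ℝ)) :
    (ε / 2) ^ t * Fintype.card X * (Fintype.card Y : ℝ) ^ t ≤
      ∑ x, ((Finset.univ.filter fun e : Fin t ↪ Y => ∀ j, S x (e j)).card : ℝ) := by
  -- Truncated so that `f x ^ t` bounds the falling factorial from below; by `hY` the loss of `t`
  -- per vertex costs at most half the density, whence `ε / 2`.
  set f : X → ℝ := fun x => max 0 ((Finset.univ.filter (S x)).card - (t : ℝ)) with hf
  have h1 : ∀ x, f x ^ t ≤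
      ((Finset.univ.filter fun e : Fin t ↪ Y => ∀ j, S x (e j)).card : ℝ) := by
    intro x
    have h2 := le_card_embeddings (S x) t
    have h3 := (Nat.pow_sub_le_descFactorial (Finset.univ.filter (S x)).card t).trans h2
    refine le_trans ?_ (Nat.cast_le.2 h3)
    rw [Nat.cast_pow]
    refine pow_le_pow_left₀ (le_max_left _ _) (max_le (by positivity) ?_) t
    rw [sub_le_iff_le_add]
    norm_cast
    omega
  refine le_trans ?_ (Finset.sum_le_sum fun x _ => h1 x)
  have hsum : ε / 2 * Fintype.card X * Fintype.card Y ≤ ∑ x, f x := by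
    have : ∑ x, ((Finset.univ.filter (S x)).card - (t : ℝ)) ≤ ∑ x, f x :=
      Finset.sum_le_sum fun x _ => le_max_right _ _
    rw [Finset.sum_sub_distrib, Finset.sum_const, Finset.card_univ, nsmul_eq_mul] at this
    have hX : (0 : ℝ) ≤ Fintype.card X := by positivity
    nlinarith
  cases t with
  | zero => simp
  | succ m =>
    rcases Nat.eq_zero_or_pos (Fintype.card X) with h0 | h0
    · rw [h0]
      simp only [Nat.cast_zero, mul_zero, zero_mul]
      exact Finset.sum_nonneg fun x _ => pow_nonneg (le_max_left _ _) _
    · have hX : (0 : ℝ) < Fintype.card X := by exact_mod_cast h0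
      have hp := pow_sum_div_card_le_sum_pow (s := Finset.univ) (f := f)
        (fun x _ => le_max_left _ _) m
      refine le_trans ?_ hp
      rw [Finset.card_univ, le_div_iff₀ (by positivity)]
      calc (ε / 2) ^ (m + 1) * Fintype.card X * (Fintype.card Y : ℝ) ^ (m + 1) *
            (Fintype.card X : ℝ) ^ m
          = (ε / 2 * Fintype.card X * Fintype.card Y) ^ (m + 1) := by ring
        _ ≤ _ := pow_le_pow_left₀ (by positivity) hsum _

open scoped Classical in
theorem exists_embedding_common {X Y : Type*} [Fintype X] [Fintype Y] (S : X → Y → Prop) (t : ℕ)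
    {ε : ℝ} (hε : 0 < ε) (hY : 2 * t ≤ ε * Fintype.card Y) (htY : t ≤ Fintype.card Y)
    (hS : ε * Fintype.card X * Fintype.card Y ≤ ∑ x, ((Finset.univ.filter (S x)).card : ℝ)) :
    ∃ e : Fin t ↪ Y, (ε / 2) ^ t * Fintype.card X ≤
      ((Finset.univ.filter fun x => ∀ j, S x (e j)).card : ℝ) := by
  have h := le_sum_card_embeddings S t hε hY hS
  have hswap : ∑ x, ((Finset.univ.filter fun e : Fin t ↪ Y => ∀ j, S x (e j)).card : ℝ) =
      ∑ e : Fin t ↪ Y, ((Finset.univ.filter fun x => ∀ j, S x (e j)).card : ℝ) := by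
    simp only [Finset.card_filter, Nat.cast_sum]
    exact Finset.sum_comm
  rw [hswap] at h
  have hne : (Finset.univ : Finset (Fin t ↪ Y)).Nonempty := by
    have : Nonempty (Fin t ↪ Y) := Function.Embedding.nonempty_of_card_le (by simpa using htY)
    exact Finset.univ_nonempty
  obtain ⟨e, -, he⟩ := Finset.exists_le_of_sum_le
    (f := fun _ : Fin t ↪ Y => (ε / 2) ^ t * (Fintype.card X : ℝ)) hne (by
      refine le_trans ?_ h
      rw [Finset.sum_const, Finset.card_univ, nsmul_eq_mul, mul_comm]
      refine mul_le_mul_of_nonneg_left ?_ (by positivity)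
      rw [Fintype.card_embedding_eq, Fintype.card_fin]
      exact_mod_cast Nat.descFactorial_le_pow _ _)
  exact ⟨e, he⟩

/-- The three edges from `W ∪ {i, j, k}` down to the sets missing `i`, `j`, or `k` are selected. -/
def IsDownTriple {ι : Type*} [DecidableEq ι] (Sel : Finset ι → ι → Prop) (W : Finset ι)
    (i j k : ι) : Prop :=
  (i ≠ j ∧ i ≠ k ∧ j ≠ k) ∧ (i ∉ W ∧ j ∉ W ∧ k ∉ W) ∧
    Sel (insert i (insert j (insert k W))) i ∧ Sel (insert i (insert j (insert k W))) j ∧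
    Sel (insert i (insert j (insert k W))) k

open scoped Classical in
theorem exists_dense_isDownTriple {ι : Type*} [Fintype ι] [DecidableEq ι]
    (Sel : Finset ι → ι → Prop) {ε : ℝ} (hε : 0 < ε) (hN : 6 ≤ ε * Fintype.card ι)
    (hS : ε * 2 ^ Fintype.card ι * Fintype.card ι ≤
      ∑ A : Finset ι, ((Finset.univ.filter fun i => i ∈ A ∧ Sel A i).card : ℝ)) :
    ∃ W : Finset ι, (ε / 2) ^ 3 * (Fintype.card ι : ℝ) ^ 3 ≤
      ((Finset.univ.filter fun p : (ι × ι) × ι => IsDownTriple Sel W p.1.1 p.1.2 p.2).card : ℝ) := by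
  have h := le_sum_card_embeddings (fun (A : Finset ι) i => i ∈ A ∧ Sel A i) 3 hε
    (by norm_num; exact hN) (by
      rw [Fintype.card_finset, Nat.cast_pow, Nat.cast_ofNat]
      exact hS.trans (le_of_eq (by congr!)))
  rw [Fintype.card_finset, Nat.cast_pow, Nat.cast_ofNat] at h
  have hle : ∑ A : Finset ι, (Finset.univ.filter
        fun e : Fin 3 ↪ ι => ∀ j, e j ∈ A ∧ Sel A (e j)).card ≤
      ∑ W : Finset ι, (Finset.univ.filter
        fun p : (ι × ι) × ι => IsDownTriple Sel W p.1.1 p.1.2 p.2).card := by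
    rw [← Finset.card_sigma, ← Finset.card_sigma]
    -- A set with three selected elements is recovered from those elements and what remains after
    -- erasing them. There are only `2 ^ |ι|` remainders `W`, so some `W` carries the average number
    -- of triples.
    refine Finset.card_le_card_of_injOn
      (fun x => ⟨((x.1.erase (x.2 0)).erase (x.2 1)).erase (x.2 2), ((x.2 0, x.2 1), x.2 2)⟩) ?_ ?_
    · rintro ⟨A, e⟩ hx
      simp only [Finset.coe_sigma, Set.mem_sigma_iff, Finset.coe_univ, Set.mem_univ, true_and,
        Finset.coe_filter, Set.mem_ofPred_eq, Finset.mem_univ] at hx ⊢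
      have h01 : e 0 ≠ e 1 := fun h => by simpa using e.injective h
      have h02 : e 0 ≠ e 2 := fun h => by simpa using e.injective h
      have h12 : e 1 ≠ e 2 := fun h => by simpa using e.injective h
      have hA : insert (e 0) (insert (e 1) (insert (e 2)
          (((A.erase (e 0)).erase (e 1)).erase (e 2)))) = A := by
        ext a
        simp only [Finset.mem_insert, Finset.mem_erase]
        have := (hx 0).1
        have := (hx 1).1
        have := (hx 2).1
        grind
      refine ⟨⟨h01, h02, h12⟩, by simp, ?_⟩
      rw [hA]
      exact ⟨(hx 0).2, (hx 1).2, (hx 2).2⟩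
    · rintro ⟨A, e⟩ hx ⟨B, e'⟩ hy hxy
      simp only [Finset.coe_sigma, Set.mem_sigma_iff, Finset.coe_univ, Set.mem_univ, true_and,
        Finset.coe_filter, Set.mem_ofPred_eq, Finset.mem_univ] at hx hy
      simp only [Sigma.mk.injEq, heq_eq_eq, Prod.mk.injEq] at hxy
      obtain ⟨hW, ⟨h0, h1⟩, h2⟩ := hxy
      have he : e = e' := by
        ext j; fin_cases j <;> assumption
      subst he
      have hAB : A = B := by
        ext a
        have := (hx 0).1
        have := (hx 1).1
        have := (hx 2).1
        have := (hy 0).1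
        have := (hy 1).1
        have := (hy 2).1
        have hWa := Finset.ext_iff.1 hW a
        simp only [Finset.mem_erase] at hWa
        grind
      rw [hAB]
  obtain ⟨W, -, hW⟩ := Finset.exists_le_of_sum_le (s := (Finset.univ : Finset (Finset ι)))
    (f := fun _ => (ε / 2) ^ 3 * (Fintype.card ι : ℝ) ^ 3)
    (g := fun W => ((Finset.univ.filter
        fun p : (ι × ι) × ι => IsDownTriple Sel W p.1.1 p.1.2 p.2).card : ℝ)) ⟨∅, by simp⟩ (by
      refine le_trans (le_of_eq ?_) (h.trans (le_trans (le_of_eq (by push_cast; congr!))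
        (Nat.cast_le (α := ℝ).2 hle |>.trans (le_of_eq (by push_cast; congr!)))))
      rw [Finset.sum_const, Finset.card_univ, Fintype.card_finset, nsmul_eq_mul]
      push_cast
      ring)
  exact ⟨W, hW⟩

theorem card_filter_prod_eq_sum {X Y : Type*} [Fintype X] [Fintype Y] (P : X × Y → Prop)
    [DecidablePred P] :
    ((Finset.univ.filter P).card : ℝ) =
      ∑ x, ((Finset.univ.filter fun y => P (x, y)).card : ℝ) := by
  simp only [Finset.card_filter, Nat.cast_sum]
  rw [Fintype.sum_prod_type]

/-- A dense set of edges of a large cube contains all edges between the complete tripartite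
system of triples and the pairs below them, over some common set `W`. -/
theorem exists_complete_isDownTriple (t : ℕ) {ε : ℝ} (hε : 0 < ε) :
    ∃ N₀ : ℕ, ∀ (ι : Type) [Fintype ι] [DecidableEq ι] (Sel : Finset ι → ι → Prop),
      N₀ ≤ Fintype.card ι →
      (open scoped Classical in ε * 2 ^ Fintype.card ι * Fintype.card ι ≤
        ∑ A : Finset ι, ((Finset.univ.filter fun i => i ∈ A ∧ Sel A i).card : ℝ)) →
      ∃ (W : Finset ι) (a b c : Fin t ↪ ι), ∀ i j k, IsDownTriple Sel W (a i) (b j) (c k) := by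
  classical
  set ε₁ : ℝ := (ε / 2) ^ 3 with hε₁
  set ε₂ : ℝ := (ε₁ / 2) ^ t with hε₂
  set ε₃ : ℝ := (ε₂ / 2) ^ t with hε₃
  have p1 : 0 < ε₁ := by positivity
  have p2 : 0 < ε₂ := by positivity
  have p3 : 0 < ε₃ := by positivity
  have hlarge : ∀ (δ C : ℝ), 0 < δ → ∃ N : ℕ, ∀ M : ℕ, N ≤ M → C ≤ δ * M := by
    intro δ C hδ
    refine ⟨⌈C / δ⌉₊, fun M hM => ?_⟩
    have := (Nat.le_ceil (C / δ)).trans (Nat.cast_le.2 hM)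
    rwa [div_le_iff₀' hδ] at this
  obtain ⟨n0, hn0⟩ := hlarge ε 6 hε
  obtain ⟨n1, hn1⟩ := hlarge ε₁ (2 * t) p1
  obtain ⟨n2, hn2⟩ := hlarge ε₂ (2 * t) p2
  obtain ⟨n3, hn3⟩ := hlarge ε₃ (2 * t) p3
  refine ⟨n0 + n1 + n2 + n3 + t, fun ι _ _ Sel hN hS => ?_⟩
  obtain ⟨W, hW⟩ := exists_dense_isDownTriple Sel hε (hn0 _ (by omega)) hS
  rw [card_filter_prod_eq_sum] at hW
  -- Erdős's argument for 3-partite 3-uniform hypergraphs: one coordinate at a time is replaced by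
  -- `t` common values, each time keeping a positive density in the others. At the last coordinate
  -- the remaining factor is `Unit`.
  obtain ⟨c, hc⟩ := exists_embedding_common
    (fun (p : ι × ι) k => IsDownTriple Sel W p.1 p.2 k) t p1 (hn1 _ (by omega)) (by omega) (by
      refine le_trans (le_of_eq ?_) (hW.trans (le_of_eq (by congr!)))
      rw [Fintype.card_prod]; push_cast; ring)
  rw [card_filter_prod_eq_sum] at hc
  obtain ⟨b, hb⟩ := exists_embedding_common
    (fun (i : ι) j => ∀ k, IsDownTriple Sel W i j (c k)) t p2 (hn2 _ (by omega)) (by omega) (by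
      refine le_trans (le_of_eq ?_) (hc.trans (le_of_eq (by congr!)))
      rw [Fintype.card_prod]; push_cast; ring)
  obtain ⟨a, ha⟩ := exists_embedding_common
    (fun (_ : Unit) i => ∀ j k, IsDownTriple Sel W i (b j) (c k)) t p3 (hn3 _ (by omega))
    (by omega) (by
      simp only [Fintype.card_unit, Nat.cast_one, mul_one, Finset.univ_unique,
        Finset.sum_singleton]
      exact hb.trans (le_of_eq (by congr!)))
  have hpos : 0 < (Finset.univ.filter fun _ : Unit =>
      ∀ i j k, IsDownTriple Sel W (a i) (b j) (c k)).card := by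
    have : (0 : ℝ) < (ε₃ / 2) ^ t * Fintype.card Unit := by simp; positivity
    rw [← Nat.cast_pos (α := ℝ)]
    exact this.trans_le (ha.trans (le_of_eq (by congr!)))
  obtain ⟨u, hu⟩ := Finset.card_pos.1 hpos
  exact ⟨W, a, b, c, (Finset.mem_filter.1 hu).2⟩

/-! ### Induced even cycles from grid cycles -/

/-- Adjacency of two positions below `L` on a cycle of length `L`. -/
def CycAdj (L m m' : ℕ) : Prop :=
  m + 1 = m' ∨ m' + 1 = m ∨ (m = 0 ∧ m' + 1 = L) ∨ (m' = 0 ∧ m + 1 = L)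

/-- A cyclic sequence of `l` points `(x i, y i, z i)` of a three-dimensional grid such that
consecutive points differ only in the coordinate `dir i`, and the axis-parallel line joining them
contains no other point of the sequence. -/
structure GridCycle (l : ℕ) where
  x : ℕ → ℕ
  y : ℕ → ℕ
  z : ℕ → ℕ
  dir : ℕ → ℕ
  dir_lt : ∀ i < l, dir i < 3
  three_le : 3 ≤ l
  inj : ∀ i < l, ∀ j < l, x i = x j → y i = y j → z i = z j → i = j
  onLine : ∀ i < l, ∀ j < l,
    ((dir j ≠ 0 → x i = x j) ∧ (dir j ≠ 1 → y i = y j) ∧ (dir j ≠ 2 → z i = z j)) ↔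
      (i = j ∨ i = j + 1 ∨ (i = 0 ∧ j + 1 = l))

/-- A planar staircase from `(0, 0)` to `(j, j)`, closed through the corner `(0, j)`. -/
theorem nonempty_gridCycle_even (j : ℕ) (hj : 1 ≤ j) : Nonempty (GridCycle (2 * j + 2)) := by
  refine ⟨⟨fun i => if i ≤ 2 * j then (i + 1) / 2 else 0, fun i => if i ≤ 2 * j then i / 2 else j,
    fun _ => 0, fun i => i % 2, ?_, by omega, ?_, ?_⟩⟩
  · intro i _; omega
  · intro i hi k hk; split_ifs <;> omega
  · intro i hi k hk
    have : i % 2 = 0 ∨ i % 2 = 1 := by omega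
    have : k % 2 = 0 ∨ k % 2 = 1 := by omega
    split_ifs <;> omega

/-- A staircase in the plane `z = 0` from the origin to `(j, j - 1, 0)`, lifted to `z = 1`,
returning through `(0, j - 1, 1)` and `(0, 0, 1)`, then dropping back to the origin. -/
theorem nonempty_gridCycle_odd (j : ℕ) (hj : 2 ≤ j) : Nonempty (GridCycle (2 * j + 3)) := by
  refine ⟨⟨fun i => if i < 2 * j then (i + 1) / 2 else if i = 2 * j then j else 0,
    fun i => if i < 2 * j then i / 2 else if i ≤ 2 * j + 1 then j - 1 else 0,
    fun i => if i < 2 * j then 0 else 1,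
    fun i => if i + 1 < 2 * j then i % 2 else if i + 1 = 2 * j then 2 else i - 2 * j,
    ?_, by omega, ?_, ?_⟩⟩
  · intro i _
    split_ifs <;> omega
  · intro i hi k hk
    split_ifs <;> simp only [false_imp_iff, imp_true_iff] <;> omega
  · intro i hi k hk
    rcases lt_trichotomy (k + 1) (2 * j) with h1 | h1 | h1
    · rcases Nat.mod_two_eq_zero_or_one k with h2 | h2 <;>
      rcases lt_trichotomy i (2 * j) with h3 | h3 | h3 <;> simp [*] <;> split_ifs <;>
        first | omega | (simp only [and_false, false_iff]; omega)
    · split_ifs <;> omega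
    · obtain h2 | h2 | h2 : k = 2 * j ∨ k = 2 * j + 1 ∨ k = 2 * j + 2 := by omega
      all_goals split_ifs <;> first | omega | (simp only [imp_false]; omega)

theorem nonempty_gridCycle (l : ℕ) (hl : l = 4 ∨ 6 ≤ l) : Nonempty (GridCycle l) := by
  rcases Nat.even_or_odd' l with ⟨k, rfl | rfl⟩
  · obtain ⟨j, rfl⟩ : ∃ j, k = j + 1 := ⟨k - 1, by omega⟩
    exact nonempty_gridCycle_even j (by omega)
  · obtain ⟨j, rfl⟩ : ∃ j, k = j + 1 := ⟨k - 1, by omega⟩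
    exact nonempty_gridCycle_odd j (by omega)

/-- The edge from `A` down to `B` of the cube is selected. -/
def IsDownEdge {ι : Type*} [DecidableEq ι] (Sel : Finset ι → ι → Prop) (A B : Finset ι) : Prop :=
  ∃ i ∈ A, Sel A i ∧ B = A.erase i

/-- Each grid point becomes the set `W ∪ {x, y, z}`, and each grid line the set obtained by erasing
the coordinate along which it runs. Containment then means that the point is on the line, so
`onLine` says exactly that the cycle is induced. -/
theorem exists_induced_cycle_of_isDownTriple {ι : Type*} [DecidableEq ι]
    {Sel : Finset ι → ι → Prop} {l t : ℕ} (P : GridCycle l)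
    (ht : ∀ i < l, P.x i < t ∧ P.y i < t ∧ P.z i < t) {W : Finset ι} {a b c : Fin t ↪ ι}
    (h : ∀ i j k, IsDownTriple Sel W (a i) (b j) (c k)) :
    ∃ g : ℕ → Finset ι, (∀ m < 2 * l, ∀ m' < 2 * l, g m = g m' → m = m') ∧
      (∀ m < 2 * l, ∀ m' < 2 * l, (g m ⋖ g m' ∨ g m' ⋖ g m) ↔ CycAdj (2 * l) m m') ∧
      (∀ i < l, IsDownEdge Sel (g (2 * i)) (g (2 * i + 1))) ∧
      (∀ i, i + 1 < l → IsDownEdge Sel (g (2 * i + 2)) (g (2 * i + 1))) ∧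
      IsDownEdge Sel (g 0) (g (2 * l - 1)) := by
  have hl := P.three_le
  have t0 : 0 < t := by have := ht 0 (by omega); omega
  -- The default value is immaterial for the cycle: coordinates at positions below `l` are less than
  -- `t`.
  let f : ℕ → Fin t := fun i => if hi : i < t then ⟨i, hi⟩ else ⟨0, t0⟩
  have hf : ∀ i < t, ∀ j < t, f i = f j → i = j := by
    intro i hi j hj hij
    simp only [f, hi, hj, dif_pos, Fin.mk.injEq] at hij
    exact hij
  obtain ⟨x, hx⟩ : ∃ x : ℕ → ι, x = fun i => a (f (P.x i)) := ⟨_, rfl⟩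
  obtain ⟨y, hy⟩ : ∃ y : ℕ → ι, y = fun i => b (f (P.y i)) := ⟨_, rfl⟩
  obtain ⟨z, hz⟩ : ∃ z : ℕ → ι, z = fun i => c (f (P.z i)) := ⟨_, rfl⟩
  have hT : ∀ i j k, IsDownTriple Sel W (x i) (y j) (z k) := fun i j k => by
    rw [hx, hy, hz]; exact h _ _ _
  have xi : ∀ i < l, ∀ j < l, x i = x j ↔ P.x i = P.x j := fun i hi j hj => by
    rw [hx]
    exact ⟨fun e => hf _ (ht i hi).1 _ (ht j hj).1 (a.injective e), fun e => by simp only [e]⟩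
  have yi : ∀ i < l, ∀ j < l, y i = y j ↔ P.y i = P.y j := fun i hi j hj => by
    rw [hy]
    exact ⟨fun e => hf _ (ht i hi).2.1 _ (ht j hj).2.1 (b.injective e), fun e => by simp only [e]⟩
  have zi : ∀ i < l, ∀ j < l, z i = z j ↔ P.z i = P.z j := fun i hi j hj => by
    rw [hz]
    exact ⟨fun e => hf _ (ht i hi).2.2 _ (ht j hj).2.2 (c.injective e), fun e => by simp only [e]⟩
  have hxy : ∀ i j, x i ≠ y j := fun i j => (hT i j 0).1.1
  have hxz : ∀ i j, x i ≠ z j := fun i j => (hT i 0 j).1.2.1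
  have hyz : ∀ i j, y i ≠ z j := fun i j => (hT 0 i j).1.2.2
  have hxW : ∀ i, x i ∉ W := fun i => (hT i 0 0).2.1.1
  have hyW : ∀ i, y i ∉ W := fun i => (hT 0 i 0).2.1.2.1
  have hzW : ∀ i, z i ∉ W := fun i => (hT 0 0 i).2.1.2.2
  let top : ℕ → Finset ι := fun i => insert (x i) (insert (y i) (insert (z i) W))
  let elt : ℕ → ι := fun i => if P.dir i = 0 then x i else if P.dir i = 1 then y i else z i
  have elt_mem : ∀ i, elt i ∈ top i := fun i => by
    simp only [elt, top, Finset.mem_insert]; split_ifs <;> simp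
  let bot : ℕ → Finset ι := fun i => (top i).erase (elt i)
  have card_top : ∀ i, (top i).card = W.card + 3 := fun i => by
    simp only [top]
    rw [Finset.card_insert_of_notMem, Finset.card_insert_of_notMem, Finset.card_insert_of_notMem]
    · exact hzW i
    · simp [hyW, hyz]
    · simp [hxW, hxy, hxz]
  have card_bot : ∀ i, (bot i).card = W.card + 2 := fun i => by
    simp only [bot]
    rw [Finset.card_erase_of_mem (elt_mem i), card_top]; rfl
  have hsel : ∀ i, Sel (top i) (x i) ∧ Sel (top i) (y i) ∧ Sel (top i) (z i) := fun i =>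
    (hT i i i).2.2
  have dir3 : ∀ j < l, P.dir j = 0 ∨ P.dir j = 1 ∨ P.dir j = 2 := fun j hj => by
    have := P.dir_lt j hj; omega
  have hsub : ∀ i < l, ∀ j < l, bot j ⊆ top i ↔ (i = j ∨ i = j + 1 ∨ (i = 0 ∧ j + 1 = l)) := by
    intro i hi j hj
    rw [← P.onLine i hi j hj, ← xi i hi j hj, ← yi i hi j hj, ← zi i hi j hj]
    simp only [bot, top, elt, Finset.subset_iff, Finset.mem_erase, Finset.mem_insert]
    have := hxy i j; have := hxy j i; have := hxz i j; have := hxz j i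
    have := hyz i j; have := hyz j i; have := hxW i; have := hxW j
    have := hyW i; have := hyW j; have := hzW i; have := hzW j
    have := hxy j j; have := hyz j j; have := hxz j j
    rcases dir3 j hj with hd | hd | hd
    · simp only [hd]
      constructor
      · intro H
        have h1 := @H (y j)
        have h2 := @H (z j)
        grind
      · grind
    · simp only [hd]
      constructor
      · intro H
        have h1 := @H (x j)
        have h2 := @H (z j)
        grind
      · grind
    · simp only [hd]
      constructor
      · intro H
        have h1 := @H (x j)
        have h2 := @H (y j)
        grind
      · grind
  have hcov : ∀ i j, bot j ⋖ top i ↔ bot j ⊆ top i := fun i j => by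
    rw [Finset.covBy_iff_card_sdiff_eq_one]
    refine ⟨fun h => h.1, fun h => ⟨h, ?_⟩⟩
    rw [Finset.card_sdiff_of_subset h, card_top, card_bot]; omega
  have hcard : ∀ A B : Finset ι, A ⋖ B → B.card = A.card + 1 := fun A B hAB => by
    obtain ⟨i, hi, rfl⟩ := Finset.covBy_iff_exists_insert.1 hAB
    exact Finset.card_insert_of_notMem hi
  have top_inj : ∀ i < l, ∀ j < l, top i = top j → i = j := by
    intro i hi j hj hij
    have h1 : x i ∈ top j := hij ▸ (by simp [top])
    have h2 : y i ∈ top j := hij ▸ (by simp [top])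
    have h3 : z i ∈ top j := hij ▸ (by simp [top])
    simp only [top, Finset.mem_insert] at h1 h2 h3
    refine P.inj i hi j hj ((xi i hi j hj).1 ?_) ((yi i hi j hj).1 ?_) ((zi i hi j hj).1 ?_)
    · have := hxy i j; have := hxz i j; have := hxW i; tauto
    · have := (hxy j i).symm; have := hyz i j; have := hyW i; tauto
    · have := (hxz j i).symm; have := (hyz j i).symm; have := hzW i; tauto
  have bot_sub : ∀ i, bot i ⊆ top i := fun i => Finset.erase_subset _ _
  have bot_inj : ∀ i < l, ∀ j < l, bot i = bot j → i = j := by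
    intro i hi j hj hij
    have h1 := (hsub i hi j hj).1 (hij ▸ bot_sub i)
    have h2 := (hsub j hj i hi).1 (hij ▸ bot_sub j)
    omega
  -- The erased element is outside `W`, since `W ⊆ bot j`; it is thus one of the three elements for
  -- which the triple selects the edge.
  have heq : ∀ i j, bot j ⊆ top i → IsDownEdge Sel (top i) (bot j) := by
    intro i j hs
    obtain ⟨e, he, hb⟩ := Finset.covBy_iff_exists_erase.1 ((hcov i j).2 hs)
    refine ⟨e, he, ?_, hb.symm⟩
    have hW : e ∉ W := fun hW => by
      have : e ∈ bot j := Finset.mem_erase.2 ⟨?_, by simp [top, hW]⟩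
      · rw [← hb] at this; simp at this
      · have := hxW j; have := hyW j; have := hzW j
        simp only [elt]
        split_ifs <;> rintro rfl <;> contradiction
    simp only [top, Finset.mem_insert] at he
    rcases he with rfl | rfl | rfl | he
    · exact (hsel i).1
    · exact (hsel i).2.1
    · exact (hsel i).2.2
    · exact absurd he hW
  let g : ℕ → Finset ι := fun m => if m % 2 = 0 then top (m / 2) else bot (m / 2)
  have g0 : ∀ i, g (2 * i) = top i := fun i => by simp [g]
  have g1 : ∀ i, g (2 * i + 1) = bot i := fun i => by
    have h1 : (2 * i + 1) % 2 ≠ 0 := by omega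
    have h2 : (2 * i + 1) / 2 = i := by omega
    simp only [g, h1, h2, if_false]
  refine ⟨g, ?_, ?_, ?_, ?_, ?_⟩
  · intro m hm m' hm' hmm
    rcases Nat.even_or_odd' m with ⟨i, rfl | rfl⟩ <;> rcases Nat.even_or_odd' m' with ⟨j, rfl | rfl⟩
    · rw [g0, g0] at hmm
      rw [top_inj i (by omega) j (by omega) hmm]
    · rw [g0, g1] at hmm
      have := congrArg Finset.card hmm
      rw [card_top, card_bot] at this; omega
    · rw [g0, g1] at hmm
      have := congrArg Finset.card hmm
      rw [card_top, card_bot] at this; omega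
    · rw [g1, g1] at hmm
      rw [bot_inj i (by omega) j (by omega) hmm]
  · intro m hm m' hm'
    unfold CycAdj
    rcases Nat.even_or_odd' m with ⟨i, rfl | rfl⟩ <;> rcases Nat.even_or_odd' m' with ⟨j, rfl | rfl⟩
    · rw [g0, g0]
      refine iff_of_false ?_ (by omega)
      rintro (h | h) <;> have := hcard _ _ h <;> rw [card_top, card_top] at this <;> omega
    · rw [g0, g1]
      have h1 : ¬ top i ⋖ bot j := fun h => by
        have := hcard _ _ h
        rw [card_top, card_bot] at this; omega
      rw [or_iff_right h1, hcov, hsub i (by omega) j (by omega)]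
      omega
    · rw [g0, g1]
      have h1 : ¬ top j ⋖ bot i := fun h => by
        have := hcard _ _ h
        rw [card_top, card_bot] at this; omega
      rw [or_iff_left h1, hcov, hsub j (by omega) i (by omega)]
      omega
    · rw [g1, g1]
      refine iff_of_false ?_ (by omega)
      rintro (h | h) <;> have := hcard _ _ h <;> rw [card_bot, card_bot] at this <;> omega
  · intro i hi
    rw [g0, g1]
    exact heq i i (bot_sub i)
  · intro i hi
    rw [show 2 * i + 2 = 2 * (i + 1) by ring, g0, g1]
    exact heq _ _ ((hsub _ hi _ (by omega)).2 (by omega))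
  · rw [show 0 = 2 * 0 by rfl, show 2 * l - 1 = 2 * (l - 1) + 1 by omega, g0, g1]
    exact heq _ _ ((hsub _ (by omega) _ (by omega)).2 (by omega))

/-- A dense set of edges of a large cube contains an induced cycle of length `2 * l`. -/
theorem exists_induced_cycle_of_dense (l : ℕ) (hl : l = 4 ∨ 6 ≤ l) {ε : ℝ} (hε : 0 < ε) :
    ∃ N₀ : ℕ, ∀ (ι : Type) [Fintype ι] [DecidableEq ι] (Sel : Finset ι → ι → Prop),
      N₀ ≤ Fintype.card ι →
      (open scoped Classical in ε * 2 ^ Fintype.card ι * Fintype.card ι ≤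
        ∑ A : Finset ι, ((Finset.univ.filter fun i => i ∈ A ∧ Sel A i).card : ℝ)) →
      ∃ g : ℕ → Finset ι, (∀ m < 2 * l, ∀ m' < 2 * l, g m = g m' → m = m') ∧
        (∀ m < 2 * l, ∀ m' < 2 * l, (g m ⋖ g m' ∨ g m' ⋖ g m) ↔ CycAdj (2 * l) m m') ∧
        (∀ i < l, IsDownEdge Sel (g (2 * i)) (g (2 * i + 1))) ∧
        (∀ i, i + 1 < l → IsDownEdge Sel (g (2 * i + 2)) (g (2 * i + 1))) ∧
        IsDownEdge Sel (g 0) (g (2 * l - 1)) := by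
  obtain ⟨P⟩ := nonempty_gridCycle l hl
  let t := (Finset.range l).sup (fun i => P.x i + P.y i + P.z i) + 1
  obtain ⟨N₀, hN₀⟩ := exists_complete_isDownTriple t hε
  refine ⟨N₀, fun ι _ _ Sel hN hS => ?_⟩
  obtain ⟨W, a, b, c, h⟩ := hN₀ ι Sel hN hS
  refine exists_induced_cycle_of_isDownTriple P (fun i hi => ?_) h
  have : P.x i + P.y i + P.z i ≤ (Finset.range l).sup (fun i => P.x i + P.y i + P.z i) :=
    Finset.le_sup (f := fun i => P.x i + P.y i + P.z i) (Finset.mem_range.2 hi)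
  omega

/-! ### Induced forests in dense sets of cube edges -/

/-- An endpoint of a longest path works: a neighbor off the path would extend it, and a neighbor on
it other than the next vertex would close a cycle. -/
theorem SimpleGraph.IsAcyclic.exists_subsingleton_neighbors {V : Type*} [Finite V] [Nonempty V]
    {F : SimpleGraph V} (hF : F.IsAcyclic) :
    ∃ v, ∀ u w, F.Adj v u → F.Adj v w → u = w := by
  classical
  have := Fintype.ofFinite V
  let P : ℕ → Prop := fun k => ∃ (u v : V) (p : F.Walk u v), p.IsPath ∧ p.length = k
  have h0 : P 0 := by
    obtain ⟨v⟩ := ‹Nonempty V›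
    exact ⟨v, v, .nil, by simp, rfl⟩
  have hb : ∀ k, P k → k ≤ Fintype.card V := by
    rintro k ⟨u, v, p, hp, rfl⟩
    exact hp.length_lt.le
  obtain ⟨u, v, p, hp, hlen⟩ := Nat.findGreatest_spec (P := P) (Nat.zero_le (Fintype.card V)) h0
  have hmax : ∀ k, P k → k ≤ p.length := fun k hk => by
    rw [hlen]; exact Nat.le_findGreatest (hb k hk) hk
  have hsnd : ∀ w, F.Adj u w → w = p.snd := by
    intro w hw
    by_cases hws : w ∈ p.support
    · exact hF.eq_snd_of_adj_start hp hw hws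
    · have := hmax _ ⟨w, v, .cons hw.symm p, hp.cons hws, rfl⟩
      simp at this
  exact ⟨u, fun w w' hw hw' => (hsnd w hw).trans (hsnd w' hw').symm⟩

-- Among the neighbors of `x`, the set `T` itself rules out at most `|T|`, and each `z ≠ x` in `T`
-- at most two more by the codegree bound, in all at most `3 |T| < K`.
open scoped Classical in
theorem exists_adj_avoiding {X : Type*} (Q : SimpleGraph X) {S : Finset X} {K : ℕ}
    (hcodeg : ∀ x z, x ≠ z → ∀ s : Finset X, (∀ y ∈ s, Q.Adj x y ∧ Q.Adj y z) → s.card ≤ 2)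
    (hdeg : ∀ x ∈ S, K ≤ (S.filter fun y => Q.Adj x y).card)
    {x : X} (hx : x ∈ S) (T : Finset X) (hT : 3 * T.card < K) :
    ∃ y ∈ S, Q.Adj x y ∧ y ∉ T ∧ ∀ z ∈ T, z ≠ x → ¬ Q.Adj y z := by
  by_contra! h
  have hsub : (S.filter fun y => Q.Adj x y) ⊆
      T ∪ (T.erase x).biUnion fun z => S.filter fun y => Q.Adj x y ∧ Q.Adj y z := by
    intro y hy
    obtain ⟨hyS, hxy⟩ := Finset.mem_filter.1 hy
    by_cases hyT : y ∈ T
    · exact Finset.mem_union_left _ hyT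
    · obtain ⟨z, hz, hzx, hyz⟩ := h y hyS hxy hyT
      exact Finset.mem_union_right _ (Finset.mem_biUnion.2
        ⟨z, Finset.mem_erase.2 ⟨hzx, hz⟩, Finset.mem_filter.2 ⟨hyS, hxy, hyz⟩⟩)
  have h1 := (Finset.card_le_card hsub).trans (Finset.card_union_le _ _)
  have h2 : ((T.erase x).biUnion fun z => S.filter fun y => Q.Adj x y ∧ Q.Adj y z).card ≤
      (T.erase x).card * 2 := by
    refine Finset.card_biUnion_le_card_mul _ _ _ fun z hz => ?_
    refine hcodeg x z (Finset.ne_of_mem_erase hz).symm _ fun y hy => (Finset.mem_filter.1 hy).2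
  have h3 := (Finset.card_erase_le : (T.erase x).card ≤ T.card)
  have h4 := hdeg x hx
  omega

open scoped Classical in
theorem exists_induced_forest {X : Type*} (Q : SimpleGraph X) {S : Finset X} {K : ℕ}
    (hS : S.Nonempty)
    (hcodeg : ∀ x z, x ≠ z → ∀ s : Finset X, (∀ y ∈ s, Q.Adj x y ∧ Q.Adj y z) → s.card ≤ 2)
    (hdeg : ∀ x ∈ S, K ≤ (S.filter fun y => Q.Adj x y).card) (m : ℕ) (hK : 3 * m < K)
    {V : Type*} [Finite V] (F : SimpleGraph V) (hF : F.IsAcyclic) (hV : Nat.card V = m) :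
    ∃ f : V → X, Function.Injective f ∧ (∀ v, f v ∈ S) ∧
      ∀ u v, F.Adj u v ↔ Q.Adj (f u) (f v) := by
  induction m generalizing V with
  | zero =>
    have := Finite.card_eq_zero_iff.1 hV
    exact ⟨isEmptyElim, fun v => isEmptyElim v, fun v => isEmptyElim v, fun v => isEmptyElim v⟩
  | succ m ih =>
    have : Nonempty V := (Nat.card_pos_iff.1 (by omega)).1
    have := Fintype.ofFinite V
    obtain ⟨v, hv⟩ := hF.exists_subsingleton_neighbors
    have hcard : Nat.card ({v}ᶜ : Set V) = m := by
      rw [Nat.card_coe_set_eq, Set.ncard_compl, Set.ncard_singleton]; omega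
    obtain ⟨f, hinj, hfS, hadj⟩ := ih (by omega) (F.induce {v}ᶜ) (hF.induce _) hcard
    let T : Finset X := Finset.univ.image f
    have hTcard : T.card ≤ m := Finset.card_image_le.trans (by
      rw [Finset.card_univ, ← Nat.card_eq_fintype_card, hcard])
    have hfT : ∀ w, f w ∈ T := fun w => Finset.mem_image_of_mem _ (Finset.mem_univ w)
    suffices ∃ y ∈ S, y ∉ T ∧ ∀ w : ({v}ᶜ : Set V), F.Adj v w ↔ Q.Adj y (f w) by
      obtain ⟨y, hyS, hyT, hy⟩ := this
      refine ⟨fun w => if hw : w = v then y else f ⟨w, hw⟩, ?_, ?_, ?_⟩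
      · intro a b hab
        by_cases ha : a = v <;> by_cases hb : b = v <;> simp only [ha, hb, dif_pos, dif_neg,
          not_false_eq_true] at hab ⊢
        · exact absurd (hfT _) (hab ▸ hyT)
        · exact absurd (hfT _) (hab ▸ hyT)
        · exact congrArg Subtype.val (hinj hab)
      · intro a
        by_cases ha : a = v <;> simp [ha, hyS, hfS]
      · intro a b
        by_cases ha : a = v <;> by_cases hb : b = v <;> simp only [ha, hb, dif_pos, dif_neg,
          not_false_eq_true]
        · simp
        · exact hy ⟨b, hb⟩
        · rw [F.adj_comm, Q.adj_comm]; exact hy ⟨a, ha⟩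
        · exact hadj ⟨a, ha⟩ ⟨b, hb⟩
    by_cases hn : ∃ u, F.Adj v u
    · obtain ⟨u, hu⟩ := hn
      have huv : u ∈ ({v}ᶜ : Set V) := hu.ne'
      obtain ⟨y, hyS, hxy, hyT, hy⟩ :=
        exists_adj_avoiding Q hcodeg hdeg (hfS ⟨u, huv⟩) T (by omega)
      refine ⟨y, hyS, hyT, fun w => ⟨fun h => ?_, fun h => ?_⟩⟩
      · have : w = ⟨u, huv⟩ := Subtype.ext (hv _ _ h hu)
        rw [this]; exact hxy.symm
      · by_contra hw
        refine hy (f w) (hfT w) (fun he => hw ?_) h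
        rw [hinj he]; exact hu
    · push Not at hn
      obtain ⟨x, hx⟩ := hS
      obtain ⟨a, haS, -, haT, -⟩ := exists_adj_avoiding Q hcodeg hdeg hx T (by omega)
      obtain ⟨y, hyS, -, hyT, hy⟩ := exists_adj_avoiding Q hcodeg hdeg haS T (by omega)
      refine ⟨y, hyS, hyT, fun w => iff_of_false (hn _) (hy _ (hfT w) ?_)⟩
      rintro rfl
      exact haT (hfT w)

theorem hasse_finset_adj_iff {ι : Type*} [DecidableEq ι] (A B : Finset ι) :
    (SimpleGraph.hasse (Finset ι)).Adj A B ↔ ∃ i, symmDiff A B = {i} := by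
  rw [SimpleGraph.hasse_adj, Finset.covBy_iff_exists_insert, Finset.covBy_iff_exists_insert]
  constructor
  · rintro (⟨i, hi, rfl⟩ | ⟨i, hi, rfl⟩) <;> refine ⟨i, ?_⟩ <;> ext j <;>
      simp only [Finset.mem_symmDiff, Finset.mem_insert, Finset.mem_singleton] <;> grind
  · rintro ⟨i, hi⟩
    have h : ∀ j, (j ∈ A ∧ j ∉ B ∨ j ∈ B ∧ j ∉ A) ↔ j = i := fun j => by
      rw [← Finset.mem_symmDiff, hi, Finset.mem_singleton]
    by_cases hA : i ∈ A
    · refine Or.inr ⟨i, by grind, ?_⟩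
      ext j; rw [Finset.mem_insert]; grind
    · refine Or.inl ⟨i, hA, ?_⟩
      ext j; rw [Finset.mem_insert]; grind

/-- A common neighbor `B` is determined by the singleton `A ∆ B`, which lies inside the two-element
set `A ∆ C`. -/
theorem hasse_finset_card_common_neighbors_le {ι : Type*} [DecidableEq ι] (A C : Finset ι)
    (hAC : A ≠ C) (s : Finset (Finset ι))
    (hs : ∀ B ∈ s, (SimpleGraph.hasse (Finset ι)).Adj A B ∧
      (SimpleGraph.hasse (Finset ι)).Adj B C) : s.card ≤ 2 := by
  rcases s.eq_empty_or_nonempty with rfl | ⟨B₀, hB₀⟩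
  · simp
  simp only [hasse_finset_adj_iff] at hs
  have hdiff : ∀ B ∈ s, ∃ i j, i ≠ j ∧ symmDiff A B = {i} ∧ symmDiff A C = {i, j} := by
    intro B hB
    obtain ⟨⟨i, hi⟩, j, hj⟩ := hs B hB
    have h : symmDiff A C = symmDiff {i} {j} := by
      rw [← hi, ← hj, symmDiff_assoc, symmDiff_symmDiff_cancel_left]
    have hij : i ≠ j := by
      rintro rfl
      rw [symmDiff_self] at h
      exact hAC (symmDiff_eq_bot.1 h)
    refine ⟨i, j, hij, hi, ?_⟩
    rw [h]
    ext k
    simp only [Finset.mem_symmDiff, Finset.mem_insert, Finset.mem_singleton]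
    grind
  have hcard : (symmDiff A C).card = 2 := by
    obtain ⟨i, j, hij, -, h⟩ := hdiff B₀ hB₀
    rw [h, Finset.card_pair hij]
  have hmaps : s.image (symmDiff A) ⊆ (symmDiff A C).image fun i => {i} := by
    intro D hD
    obtain ⟨B, hB, rfl⟩ := Finset.mem_image.1 hD
    obtain ⟨i, j, -, h1, h2⟩ := hdiff B hB
    rw [h1, h2]
    exact Finset.mem_image_of_mem _ (by simp)
  rw [← hcard, ← Finset.card_image_of_injective s (symmDiff_right_injective A)]
  exact (Finset.card_le_card hmaps).trans Finset.card_image_le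

-- In a minimal nonempty set spanning at least `K` edges per vertex, deleting a vertex of degree
-- below `K` would preserve the ratio.
open scoped Classical in
theorem exists_finset_minDegree {X : Type*} [Fintype X] [Nonempty X] (D : X → X → Prop) (K : ℕ)
    (h : K * Fintype.card X ≤ ∑ x, (Finset.univ.filter (D x)).card) :
    ∃ S : Finset X, S.Nonempty ∧
      ∀ x ∈ S, K ≤ (S.filter fun y => D x y).card + (S.filter fun y => D y x).card := by
  let e : Finset X → ℕ := fun S => ((S ×ˢ S).filter fun p => D p.1 p.2).card
  obtain ⟨S, ⟨hne, hS⟩, hmin⟩ := (wellFounded_lt (α := Finset X)).has_min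
    {S | S.Nonempty ∧ K * S.card ≤ e S} ⟨Finset.univ, Finset.univ_nonempty, by
      refine h.trans (le_of_eq ?_)
      simp only [e, Finset.card_filter]
      rw [Finset.sum_product]⟩
  refine ⟨S, hne, fun x hx => ?_⟩
  have hsub : ((S ×ˢ S).filter fun p => D p.1 p.2) ⊆
      (((S.erase x) ×ˢ (S.erase x)).filter fun p => D p.1 p.2) ∪
        ((S.filter fun y => D x y).image fun y => (x, y)) ∪
        ((S.filter fun y => D y x).image fun y => (y, x)) := by
    rintro ⟨a, b⟩ hab
    simp only [Finset.mem_filter, Finset.mem_product, Finset.mem_union, Finset.mem_erase,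
      Finset.mem_image, Prod.mk.injEq] at hab ⊢
    by_cases ha : a = x
    · exact Or.inl (Or.inr ⟨b, ⟨hab.1.2, ha ▸ hab.2⟩, ha.symm, rfl⟩)
    · by_cases hb : b = x
      · exact Or.inr ⟨a, ⟨hab.1.1, hb ▸ hab.2⟩, rfl, hb.symm⟩
      · exact Or.inl (Or.inl ⟨⟨⟨ha, hab.1.1⟩, hb, hab.1.2⟩, hab.2⟩)
  have h1 := (Finset.card_le_card hsub).trans (Finset.card_union_le _ _)
  have h2 := Finset.card_union_le
    (((S.erase x) ×ˢ (S.erase x)).filter fun p => D p.1 p.2)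
    ((S.filter fun y => D x y).image fun y => (x, y))
  have h3 := Finset.card_image_le (s := S.filter fun y => D x y) (f := fun y => (x, y))
  have h4 := Finset.card_image_le (s := S.filter fun y => D y x) (f := fun y => (y, x))
  have h5 : e (S.erase x) ≤ K * (S.card - 1) := by
    rcases (S.erase x).eq_empty_or_nonempty with h0 | h0
    · rw [h0]; simp [e]
    · by_contra! hlt
      refine hmin (S.erase x) ⟨h0, ?_⟩ (Finset.erase_ssubset hx)
      rw [Finset.card_erase_of_mem hx]; exact hlt.le
  have h6 : K * S.card = K * (S.card - 1) + K := by
    have := Finset.card_pos.2 hne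
    obtain ⟨c, hc⟩ : ∃ c, S.card = c + 1 := ⟨S.card - 1, by omega⟩
    rw [hc]; simp; ring
  simp only [e] at hS h5
  omega

/-- A dense set of edges of a large cube has a nonempty vertex set on which every finite forest
with `m` vertices embeds as an induced subgraph, each vertex lying on a selected edge. -/
theorem exists_induced_forest_of_dense (m : ℕ) {ε : ℝ} (hε : 0 < ε) :
    ∃ N₀ : ℕ, ∀ (ι : Type) [Fintype ι] [DecidableEq ι] (Sel : Finset ι → ι → Prop),
      N₀ ≤ Fintype.card ι →
      (open scoped Classical in ε * 2 ^ Fintype.card ι * Fintype.card ι ≤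
        ∑ A : Finset ι, ((Finset.univ.filter fun i => i ∈ A ∧ Sel A i).card : ℝ)) →
      ∀ {V : Type*} [Finite V] (F : SimpleGraph V), F.IsAcyclic → Nat.card V = m →
        ∃ f : V → Finset ι, Function.Injective f ∧
          (∀ v, ∃ B, IsDownEdge Sel (f v) B ∨ IsDownEdge Sel B (f v)) ∧
          ∀ u v, F.Adj u v ↔ (SimpleGraph.hasse (Finset ι)).Adj (f u) (f v) := by
  classical
  let K := 3 * m + 1
  refine ⟨⌈(2 * K) / ε⌉₊, fun ι _ _ Sel hN hS V _ F hF hV => ?_⟩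
  have hN' : 2 * (K : ℝ) ≤ ε * Fintype.card ι := by
    have := (Nat.le_ceil ((2 * K : ℝ) / ε)).trans (Nat.cast_le.2 hN)
    rwa [div_le_iff₀' hε] at this
  -- Out-degree and in-degree sum to at least `2 * K`, and each is at most the degree in the cube,
  -- which is therefore at least `K`.
  obtain ⟨S, hne, hdeg⟩ := exists_finset_minDegree (IsDownEdge Sel) (2 * K) (by
    have h1 : ∀ A : Finset ι, (Finset.univ.filter fun i => i ∈ A ∧ Sel A i).card ≤
        (Finset.univ.filter (IsDownEdge Sel A)).card := fun A => by
      refine Finset.card_le_card_of_injOn (fun i => A.erase i) ?_ ?_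
      · intro i hi
        simp only [Finset.coe_filter, Finset.mem_univ, true_and, Set.mem_ofPred_eq] at hi ⊢
        exact ⟨i, hi.1, hi.2, rfl⟩
      · intro i hi j hj hij
        simp only [Finset.coe_filter, Finset.mem_univ, true_and, Set.mem_ofPred_eq] at hi hj
        exact (Finset.erase_inj A hi.1).1 hij
    have h2 : ((2 * K * Fintype.card (Finset ι) : ℕ) : ℝ) ≤
        ∑ A : Finset ι, ((Finset.univ.filter fun i => i ∈ A ∧ Sel A i).card : ℝ) := by
      refine le_trans ?_ (hS.trans (le_of_eq (by congr!)))
      rw [Fintype.card_finset]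
      push_cast
      have : (0 : ℝ) < 2 ^ Fintype.card ι := by positivity
      nlinarith
    have h3 := Finset.sum_le_sum fun A (_ : A ∈ (Finset.univ : Finset (Finset ι))) => h1 A
    rw [← Nat.cast_sum, Nat.cast_le] at h2
    exact h2.trans h3)
  have hadj : ∀ A B, IsDownEdge Sel A B → B ⋖ A := fun A B => by
    rintro ⟨i, hi, -, rfl⟩
    exact Finset.covBy_iff_exists_erase.2 ⟨i, hi, rfl⟩
  obtain ⟨f, hinj, hfS, hf⟩ := exists_induced_forest (SimpleGraph.hasse (Finset ι)) (K := K) hne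
    hasse_finset_card_common_neighbors_le (fun x hx => by
      have h1 := hdeg x hx
      have h2 : (S.filter fun y => IsDownEdge Sel x y).card ≤
          (S.filter fun y => (SimpleGraph.hasse (Finset ι)).Adj x y).card :=
        Finset.card_le_card (Finset.monotone_filter_right S fun y _ h => Or.inr (hadj _ _ h))
      have h3 : (S.filter fun y => IsDownEdge Sel y x).card ≤
          (S.filter fun y => (SimpleGraph.hasse (Finset ι)).Adj x y).card :=
        Finset.card_le_card (Finset.monotone_filter_right S fun y _ h => Or.inl (hadj _ _ h))
      omega) m (by omega) F hF hV
  refine ⟨f, hinj, fun v => ?_, hf⟩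
  have h1 := hdeg _ (hfS v)
  by_contra! hcon
  have e1 : (S.filter fun y => IsDownEdge Sel (f v) y) = ∅ :=
    Finset.filter_eq_empty_iff.2 fun y _ => (hcon y).1
  have e2 : (S.filter fun y => IsDownEdge Sel y (f v)) = ∅ :=
    Finset.filter_eq_empty_iff.2 fun y _ => (hcon y).2
  rw [e1, e2] at h1
  simp [K] at h1

/-! ### Generic unit cubes in Euclidean space -/

theorem exists_generic_word_map {n : ℕ} (hn : 2 ≤ n) (V : Finset (EuclideanSpace ℝ (Fin n)))
    (N : ℕ) :
    ∃ φ : (Fin N → EuclideanSpace ℝ (Fin n)) → EuclideanSpace ℝ (Fin n),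
      (∀ w w', (∀ i, w i ∈ V) → (∀ i, w' i ∈ V) → φ w = φ w' → w = w') ∧
      (∀ w w', (∀ i, w i ∈ V) → (∀ i, w' i ∈ V) → dist (φ w) (φ w') = 1 →
        ∃ i, w i ≠ w' i ∧ ∀ j ≠ i, w j = w' j) ∧
      ∀ w i, Isometry fun v => φ (Function.update w i v) := by
  obtain ⟨R, hR⟩ := exists_generic_isometries hn
    ((fun p : EuclideanSpace ℝ (Fin n) × EuclideanSpace ℝ (Fin n) => p.1 - p.2) ''
      ((V : Set _) ×ˢ (V : Set _)))
    ((V.finite_toSet.prod V.finite_toSet).image _) N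
  have hsub : ∀ w w' : Fin N → EuclideanSpace ℝ (Fin n),
      ∑ i, R i (w i) - ∑ i, R i (w' i) = ∑ i, R i ((w - w') i) := fun w w' => by
    rw [← Finset.sum_sub_distrib]
    simp
  have hmem : ∀ w w' : Fin N → EuclideanSpace ℝ (Fin n), (∀ i, w i ∈ V) → (∀ i, w' i ∈ V) →
      ∀ i, (w - w') i ∈ (fun p : EuclideanSpace ℝ (Fin n) × EuclideanSpace ℝ (Fin n) =>
        p.1 - p.2) '' ((V : Set _) ×ˢ (V : Set _)) :=
    fun w w' hw hw' i => ⟨(w i, w' i), ⟨hw i, hw' i⟩, rfl⟩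
  refine ⟨fun w => ∑ i, R i (w i), fun w w' hw hw' h => ?_, fun w w' hw hw' h => ?_,
    fun w i => ?_⟩
  · by_contra hne
    refine (hR _ (hmem w w' hw hw')).1 (sub_ne_zero.2 hne) ?_
    rw [← hsub]
    exact sub_eq_zero.2 h
  · rw [dist_eq_norm, hsub] at h
    have hne : ∃ i, w i ≠ w' i := by
      by_contra! hcon
      rw [funext hcon] at h
      simp at h
    obtain ⟨i, hi⟩ := hne
    refine ⟨i, hi, fun j hj => ?_⟩
    by_contra hne
    exact (hR _ (hmem w w' hw hw')).2 j i hj (sub_ne_zero.2 hne) (sub_ne_zero.2 hi) h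
  · refine Isometry.of_dist_eq fun v v' => ?_
    rw [dist_eq_norm, hsub, Finset.sum_eq_single i, LinearIsometryEquiv.norm_map]
    · simp [dist_eq_norm]
    · intro j _ hj
      simp [hj]
    · simp

open scoped Classical in
/-- Averaging over all choices of a pair in each coordinate: if every fibre of the word space has a
good pair, then some choice of pairs has a positive proportion of good edges in the cube that it
spans. -/
theorem exists_dense_selection {ι D T : Type*} [Fintype ι] [DecidableEq ι] [Fintype D]
    [Fintype T] [Nonempty D] [Nonempty T] (G : (ι → D) → Finset ι → ι → T → Prop)
    (hG : ∀ d A i, ∃ e τ, G (Function.update d i e) (insert i A) i τ) :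
    ∃ τ d, (1 / (2 * Fintype.card D * Fintype.card T) : ℝ) * 2 ^ Fintype.card ι * Fintype.card ι ≤
      ∑ A : Finset ι, ((Finset.univ.filter fun i => i ∈ A ∧ G d A i τ).card : ℝ) := by
  choose e τ h using hG
  have h1 : ∀ i, Fintype.card (ι → D) * 2 ^ Fintype.card ι ≤ 2 * Fintype.card D *
      (Finset.univ.filter fun q : (T × (ι → D)) × Finset ι =>
        i ∈ q.2 ∧ G q.1.2 q.2 i q.1.1).card := by
    intro i
    rw [← Fintype.card_finset, ← Fintype.card_prod, ← Fintype.card_bool, ← Fintype.card_prod,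
      ← Finset.card_univ, ← Finset.card_univ, ← Finset.card_product]
    -- Moving to the good pair forgets only the old pair at `i` and whether `i ∈ A`; recording these
    -- makes the map injective and accounts for the factor `2 * |D|`.
    refine Finset.card_le_card_of_injOn (fun p => ((decide (i ∈ p.2), p.1 i),
      ((τ p.1 p.2 i, Function.update p.1 i (e p.1 p.2 i)), insert i p.2))) ?_ ?_
    · intro p _
      simp only [Finset.coe_product, Set.mem_prod, Finset.coe_univ, Set.mem_univ, true_and,
        Finset.coe_filter, Finset.mem_univ, Set.mem_ofPred_eq]
      exact ⟨Finset.mem_insert_self _ _, h _ _ _⟩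
    · rintro ⟨d, A⟩ _ ⟨d', A'⟩ _ heq
      simp only [Prod.mk.injEq, decide_eq_decide] at heq
      obtain ⟨⟨hA, hd⟩, ⟨-, hu⟩, hins⟩ := heq
      refine Prod.ext (funext fun j => ?_) (Finset.ext fun j => ?_)
      · by_cases hj : j = i
        · rw [hj]; exact hd
        · have := congrFun hu j
          simpa [hj] using this
      · have := Finset.ext_iff.1 hins j
        simp only [Finset.mem_insert] at this
        by_cases hj : j = i
        · rw [hj]; exact hA
        · simpa [hj] using this
  have h2 : ∑ i : ι, (Finset.univ.filter fun q : (T × (ι → D)) × Finset ι =>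
        i ∈ q.2 ∧ G q.1.2 q.2 i q.1.1).card =
      ∑ p : T × (ι → D), ∑ A : Finset ι,
        (Finset.univ.filter fun i => i ∈ A ∧ G p.2 A i p.1).card := by
    simp only [Finset.card_filter]
    rw [Finset.sum_comm, Fintype.sum_prod_type]
  have h3 := Finset.sum_le_sum fun i (_ : i ∈ (Finset.univ : Finset ι)) => h1 i
  rw [Finset.sum_const, Finset.card_univ, smul_eq_mul, ← Finset.mul_sum, h2] at h3
  have hD : (0 : ℝ) < Fintype.card D := by exact_mod_cast Fintype.card_pos
  have hT : (0 : ℝ) < Fintype.card T := by exact_mod_cast Fintype.card_pos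
  obtain ⟨p, -, hp⟩ := Finset.exists_le_of_sum_le (s := (Finset.univ : Finset (T × (ι → D))))
    (f := fun _ => (1 / (2 * Fintype.card D * Fintype.card T) : ℝ) * 2 ^ Fintype.card ι *
      Fintype.card ι)
    (g := fun p => ∑ A : Finset ι,
      ((Finset.univ.filter fun i => i ∈ A ∧ G p.2 A i p.1).card : ℝ)) Finset.univ_nonempty (by
      rw [Finset.sum_const, Finset.card_univ, Fintype.card_prod, nsmul_eq_mul]
      have h4 : ((Fintype.card ι * (Fintype.card (ι → D) * 2 ^ Fintype.card ι) : ℕ) : ℝ) ≤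
          ((2 * Fintype.card D * ∑ p : T × (ι → D), ∑ A : Finset ι,
            (Finset.univ.filter fun i => i ∈ A ∧ G p.2 A i p.1).card : ℕ) : ℝ) :=
        Nat.cast_le.2 h3
      push_cast at h4 ⊢
      refine le_of_mul_le_mul_left (le_trans (le_of_eq ?_) h4)
        (by positivity : (0 : ℝ) < 2 * Fintype.card D)
      field_simp)
  exact ⟨p.1, p.2, hp⟩

-- The label `τ` lets the selected edges share finite data, such as a color. The last clause about
-- `V` says that the fibre through a selected edge meets the cube only in the two ends, so a path
-- drawn in that fibre avoids the rest of the cube.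
open scoped Classical in
theorem exists_dense_unit_cube {n : ℕ} (hn : 2 ≤ n) (V : Finset (EuclideanSpace ℝ (Fin n)))
    {T : Type*} [Finite T]
    (Good : (EuclideanSpace ℝ (Fin n) → EuclideanSpace ℝ (Fin n)) → EuclideanSpace ℝ (Fin n) →
      EuclideanSpace ℝ (Fin n) → T → Prop)
    (hGood : ∀ ψ, Isometry ψ → ∃ u ∈ V, ∃ v ∈ V, dist u v = 1 ∧ ∃ τ, Good ψ u v τ) :
    ∃ ε : ℝ, 0 < ε ∧ ∀ N : ℕ, ∃ (τ : T) (Φ : Finset (Fin N) → EuclideanSpace ℝ (Fin n))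
      (Sel : Finset (Fin N) → Fin N → Prop), Function.Injective Φ ∧
      (∀ A B, (SimpleGraph.hasse (Finset (Fin N))).Adj A B ↔ dist (Φ A) (Φ B) = 1) ∧
      (∀ A B, IsDownEdge Sel A B → ∃ ψ u v, Isometry ψ ∧ Good ψ u v τ ∧ ψ u = Φ A ∧ ψ v = Φ B ∧
        ∀ x ∈ V, ∀ C, ψ x = Φ C → C = A ∨ C = B) ∧
      ε * 2 ^ Fintype.card (Fin N) * Fintype.card (Fin N) ≤
        ∑ A : Finset (Fin N), ((Finset.univ.filter fun i => i ∈ A ∧ Sel A i).card : ℝ) := by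
  have := Fintype.ofFinite T
  let D := {p : V × V // dist p.1 p.2 = 1}
  obtain ⟨hD, hT⟩ : Nonempty D ∧ Nonempty T := by
    obtain ⟨u, hu, v, hv, huv, τ, -⟩ := hGood id isometry_id
    exact ⟨⟨⟨(⟨u, hu⟩, ⟨v, hv⟩), huv⟩⟩, ⟨τ⟩⟩
  have pD : (0 : ℝ) < Fintype.card D := by exact_mod_cast Fintype.card_pos
  have pT : (0 : ℝ) < Fintype.card T := by exact_mod_cast Fintype.card_pos
  refine ⟨1 / (2 * Fintype.card D * Fintype.card T), by positivity, fun N => ?_⟩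
  obtain ⟨φ, hinj, hadj, hiso⟩ := exists_generic_word_map hn V N
  let word : (Fin N → D) → Finset (Fin N) → Fin N → EuclideanSpace ℝ (Fin n) :=
    fun d A j => if j ∈ A then (d j).1.1 else (d j).1.2
  have hword : ∀ d A j, word d A j ∈ V := fun d A j => by
    simp only [word]; split_ifs <;> exact Subtype.coe_prop _
  obtain ⟨τ, d, hdense⟩ := exists_dense_selection (ι := Fin N) (D := D) (T := T)
    (fun d A i τ => Good (fun v => φ (Function.update (word d A) i v)) (d i).1.1 (d i).1.2 τ) (by
      intro d A i
      obtain ⟨u, hu, v, hv, huv, τ, h⟩ := hGood _ (hiso (word d A) i)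
      refine ⟨⟨(⟨u, hu⟩, ⟨v, hv⟩), huv⟩, τ, ?_⟩
      -- The fibre in direction `i` depends neither on the pair chosen at `i` nor on whether `i ∈
      -- A`, so the pair found in it can be inserted at `i`.
      have heq : ∀ e : D, ∀ x, Function.update (word (Function.update d i e) (insert i A)) i x =
          Function.update (word d A) i x := fun e x => by
        funext j
        by_cases hj : j = i
        · subst hj; simp
        · simp [word, hj]
      simp only [heq, Function.update_self]
      exact h)
  have hd : ∀ j, ((d j).1.1 : EuclideanSpace ℝ (Fin n)) ≠ (d j).1.2 := fun j h => by
    have := (d j).2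
    have h' : (d j).1.1 = (d j).1.2 := Subtype.ext h
    rw [h', dist_self] at this
    exact zero_ne_one this
  have hword_iff : ∀ A B j, word d A j = word d B j ↔ (j ∈ A ↔ j ∈ B) := fun A B j => by
    simp only [word]
    have := hd j
    by_cases hA : j ∈ A <;> by_cases hB : j ∈ B <;> simp [hA, hB, this, this.symm]
  have hup : ∀ A i, φ (Function.update (word d A) i (word d A i)) = φ (word d A) := fun A i => by
    rw [Function.update_eq_self]
  have herase : ∀ A i, i ∈ A →
      Function.update (word d A) i (d i).1.2 = word d (A.erase i) := fun A i hi => by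
    funext j
    by_cases hj : j = i
    · subst hj; simp [word]
    · simp [word, hj]
  have hself : ∀ A i, i ∈ A → Function.update (word d A) i (d i).1.1 = word d A := fun A i hi => by
    funext j
    by_cases hj : j = i
    · subst hj; simp [word, hi]
    · simp [hj]
  have hdown : ∀ A i, i ∈ A → dist (φ (word d A)) (φ (word d (A.erase i))) = 1 := by
    intro A i hi
    rw [← herase A i hi]
    conv_lhs => rw [← hself A i hi]
    rw [Function.update_idem, (hiso (word d A) i).dist_eq]
    exact (d i).2
  refine ⟨τ, fun A => φ (word d A), _, ?_, ?_, ?_, hdense⟩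
  · intro A B hAB
    have := hinj _ _ (hword d A) (hword d B) hAB
    exact Finset.ext fun j => (hword_iff A B j).1 (congrFun this j)
  · intro A B
    constructor
    · rw [SimpleGraph.hasse_adj, Finset.covBy_iff_exists_erase, Finset.covBy_iff_exists_erase]
      rintro (⟨i, hi, rfl⟩ | ⟨i, hi, rfl⟩)
      · rw [dist_comm]; convert hdown B i hi
      · convert hdown A i hi
    · intro h
      obtain ⟨i, hi, hj⟩ := hadj _ _ (hword d A) (hword d B) h
      rw [hasse_finset_adj_iff]
      refine ⟨i, Finset.ext fun j => ?_⟩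
      rw [Finset.mem_symmDiff, Finset.mem_singleton]
      by_cases hji : j = i
      · have := (hword_iff A B i).not.1 hi
        subst hji
        tauto
      · have := (hword_iff A B j).1 (hj j hji)
        tauto
  · rintro A B ⟨i, hi, hsel, rfl⟩
    refine ⟨_, _, _, hiso (word d A) i, hsel, ?_, ?_, fun x hx C hC => ?_⟩
    · exact congrArg φ (hself A i hi)
    · exact congrArg φ ((herase A i hi).trans (by congr!))
    · have hw := hinj _ _ (fun j => by
        by_cases hj : j = i
        · subst hj; simpa using hx
        · simpa [hj] using hword d A j) (hword d C) hC
      have hoff : ∀ j ≠ i, (j ∈ A ↔ j ∈ C) := fun j hj => by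
        rw [← hword_iff]
        have := congrFun hw j
        simpa [hj] using this
      by_cases hiC : i ∈ C
      · refine Or.inl (Finset.ext fun j => ?_)
        by_cases hj : j = i
        · subst hj; simp [hi, hiC]
        · exact (hoff j hj).symm
      · refine Or.inr (Finset.ext fun j => ?_)
        by_cases hj : j = i
        · subst hj; simp [hiC]
        · simp [hj, hoff j hj]

/-! ### Monochromatic induced forests and even cycles -/

theorem iInf_natCast_eq {S : Set ℕ} {k : ℕ} (hk : k ∈ S) (h : ∀ r ∈ S, k ≤ r) :
    ⨅ r ∈ S, (r : ℕ∞) = k :=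
  le_antisymm (iInf₂_le k hk) (le_iInf₂ fun r hr => Nat.cast_le.2 (h r hr))

theorem not_isMonochromatic_of_isUnitCopy {n : ℕ} {C V : Type*} {H : SimpleGraph V} (hH : H ≠ ⊥)
    (c : (unitDistanceGraph n).Coloring C) {A : Set (EuclideanSpace ℝ (Fin n))}
    (hA : IsUnitCopy H A) : ¬ IsMonochromatic c A := by
  rintro ⟨κ, hκ⟩
  obtain ⟨f, -, rfl, hadj⟩ := hA
  obtain ⟨u, v, huv⟩ := SimpleGraph.ne_bot_iff_exists_adj.1 hH
  have h : (unitDistanceGraph n).Adj (f u) (f v) := hadj u v huv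
  exact c.valid h ((hκ _ ⟨u, rfl⟩).trans (hκ _ ⟨v, rfl⟩).symm)

theorem IsInducedUnitCopy.isUnitCopy {n : ℕ} {V : Type*} {H : SimpleGraph V}
    {A : Set (EuclideanSpace ℝ (Fin n))} (hA : IsInducedUnitCopy H A) : IsUnitCopy H A := by
  obtain ⟨f, h1, h2, h3⟩ := hA
  exact ⟨f, h1, h2, fun u v h => (h3 u v).1 h⟩

theorem chiGraph_eq_of_forall_lt {n k : ℕ} {V : Type*} {H : SimpleGraph V} (hH : H ≠ ⊥)
    (hk : (unitDistanceGraph n).Colorable k)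
    (hlow : ∀ r < k, ∀ c : EuclideanSpace ℝ (Fin n) → Fin r,
      ∃ A, IsInducedUnitCopy H A ∧ IsMonochromatic c A) :
    chiGraphInd n H = k ∧ chiGraph n H = k := by
  obtain ⟨c⟩ := hk
  constructor
  · refine iInf_natCast_eq
      ⟨c, fun A hA => not_isMonochromatic_of_isUnitCopy hH c hA.isUnitCopy⟩ ?_
    rintro r ⟨c, hc⟩
    by_contra! hr
    obtain ⟨A, h1, h2⟩ := hlow r hr c
    exact hc A h1 h2
  · refine iInf_natCast_eq ⟨c, fun A hA => not_isMonochromatic_of_isUnitCopy hH c hA⟩ ?_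
    rintro r ⟨c, hc⟩
    by_contra! hr
    obtain ⟨A, h1, h2⟩ := hlow r hr c
    exact hc A h1.isUnitCopy h2

/-- If `ℝⁿ` has no proper colouring with `r` colours, then every colouring with `r` colours has
monochromatic edges of positive density in generic unit cubes of every dimension. -/
theorem exists_dense_monochromatic_cube {n r : ℕ} (hn : 2 ≤ n)
    (hr : ¬ (unitDistanceGraph n).Colorable r) (c : EuclideanSpace ℝ (Fin n) → Fin r) :
    ∃ ε : ℝ, 0 < ε ∧ ∀ N : ℕ, ∃ (τ : Fin r) (Φ : Finset (Fin N) → EuclideanSpace ℝ (Fin n))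
      (Sel : Finset (Fin N) → Fin N → Prop), Function.Injective Φ ∧
      (∀ A B, (SimpleGraph.hasse (Finset (Fin N))).Adj A B ↔ dist (Φ A) (Φ B) = 1) ∧
      (∀ A B, IsDownEdge Sel A B → c (Φ A) = τ ∧ c (Φ B) = τ) ∧
      (open scoped Classical in ε * 2 ^ Fintype.card (Fin N) * Fintype.card (Fin N) ≤
        ∑ A : Finset (Fin N), ((Finset.univ.filter fun i => i ∈ A ∧ Sel A i).card : ℝ)) := by
  obtain ⟨V, hV⟩ := exists_finite_not_colorable _ r hr
  obtain ⟨ε, hε, h⟩ := exists_dense_unit_cube hn V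
    (fun ψ u v (τ : Fin r) => c (ψ u) = τ ∧ c (ψ v) = τ) (fun ψ _ => by
      by_contra! hcon
      refine hV ⟨⟨fun x => c (ψ x), fun {x y} hxy heq => ?_⟩⟩
      exact hcon x x.2 y y.2 hxy _ rfl heq.symm)
  refine ⟨ε, hε, fun N => ?_⟩
  obtain ⟨τ, Φ, Sel, h1, h2, h3, h4⟩ := h N
  refine ⟨τ, Φ, Sel, h1, h2, fun A B hAB => ?_, h4⟩
  obtain ⟨ψ, u, v, -, hg, hu, hv, -⟩ := h3 A B hAB
  rw [← hu, ← hv]; exact hg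

theorem exists_monochromatic_induced_forest {n r : ℕ} (hn : 2 ≤ n)
    (hr : ¬ (unitDistanceGraph n).Colorable r) (c : EuclideanSpace ℝ (Fin n) → Fin r)
    {V : Type*} [Finite V] {F : SimpleGraph V} (hF : F.IsAcyclic) :
    ∃ A, IsInducedUnitCopy F A ∧ IsMonochromatic c A := by
  obtain ⟨ε, hε, h⟩ := exists_dense_monochromatic_cube hn hr c
  obtain ⟨N, hN⟩ := exists_induced_forest_of_dense (Nat.card V) hε
  obtain ⟨τ, Φ, Sel, hinj, hadj, hcol, hdense⟩ := h N
  obtain ⟨f, hf, hfcol, hfadj⟩ := hN (Fin N) Sel (by simp) hdense F hF rfl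
  refine ⟨Set.range (Φ ∘ f), ⟨Φ ∘ f, hinj.comp hf, rfl, fun u v => ?_⟩, τ, ?_⟩
  · rw [hfadj, hadj]; rfl
  · rintro _ ⟨v, rfl⟩
    obtain ⟨B, hB | hB⟩ := hfcol v
    · exact (hcol _ _ hB).1
    · exact (hcol _ _ hB).2

theorem cycleGraph_adj_iff_cycAdj {m : ℕ} (hm : 3 ≤ m) (u v : Fin m) :
    (SimpleGraph.cycleGraph m).Adj u v ↔ CycAdj m u v := by
  have hsub : ∀ a b : Fin m, (a - b).val = if b.val ≤ a.val then a.val - b.val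
      else m + a.val - b.val := by
    intro a b
    rw [Fin.val_sub]
    have := a.2
    have := b.2
    split_ifs with h
    · rw [show m - b.val + a.val = (a.val - b.val) + m by omega, Nat.add_mod_right,
        Nat.mod_eq_of_lt (by omega)]
    · rw [Nat.mod_eq_of_lt (by omega)]; omega
  rw [SimpleGraph.cycleGraph_adj', hsub, hsub, CycAdj]
  have := u.2
  have := v.2
  split_ifs <;> omega

theorem cycleGraph_ne_bot {m : ℕ} (hm : 3 ≤ m) : SimpleGraph.cycleGraph m ≠ ⊥ := by
  refine SimpleGraph.ne_bot_iff_exists_adj.2 ⟨⟨0, by omega⟩, ⟨1, by omega⟩, ?_⟩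
  rw [cycleGraph_adj_iff_cycAdj hm]
  exact Or.inl rfl

theorem exists_monochromatic_induced_even_cycle {n r : ℕ} (hn : 2 ≤ n)
    (hr : ¬ (unitDistanceGraph n).Colorable r) (c : EuclideanSpace ℝ (Fin n) → Fin r)
    {l : ℕ} (hl : l = 4 ∨ 6 ≤ l) :
    ∃ A, IsInducedUnitCopy (SimpleGraph.cycleGraph (2 * l)) A ∧ IsMonochromatic c A := by
  obtain ⟨ε, hε, h⟩ := exists_dense_monochromatic_cube hn hr c
  obtain ⟨N, hN⟩ := exists_induced_cycle_of_dense l hl hε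
  obtain ⟨τ, Φ, Sel, hinj, hadj, hcol, hdense⟩ := h N
  obtain ⟨g, hg, hgadj, hgd, -⟩ := hN (Fin N) Sel (by simp) hdense
  refine ⟨Set.range fun i : Fin (2 * l) => Φ (g i), ⟨fun i => Φ (g i), fun i j hij => ?_, rfl,
    fun u v => ?_⟩, τ, ?_⟩
  · exact Fin.ext (hg i i.2 j j.2 (hinj hij))
  · rw [cycleGraph_adj_iff_cycAdj (by omega), ← hgadj u u.2 v v.2, ← hadj, SimpleGraph.hasse_adj]
  · rintro _ ⟨i, rfl⟩
    have hi := i.2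
    dsimp only
    rcases Nat.even_or_odd' i.val with ⟨j, hj | hj⟩
    · rw [hj]; exact (hcol _ _ (hgd j (by omega))).1
    · rw [hj]; exact (hcol _ _ (hgd j (by omega))).2

/-! ### Odd cycles -/

/-- Each shortcut made by `bypass` removes an edge together with a path joining its ends. That path
is odd by assumption, so an even number of steps is lost. -/
theorem SimpleGraph.Walk.even_bypass_length_iff {V : Type*} [DecidableEq V] {G : SimpleGraph V}
    (hG : ∀ u v, G.Adj u v → ∀ p : G.Walk v u, p.IsPath → ¬ Even p.length) {u v : V}
    (p : G.Walk u v) : Even p.bypass.length ↔ Even p.length := by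
  induction p with
  | nil => simp [SimpleGraph.Walk.bypass]
  | cons h p ih =>
    rename_i a b d
    simp only [SimpleGraph.Walk.bypass]
    split_ifs with hs
    · have h1 := congrArg SimpleGraph.Walk.length (p.bypass.take_spec hs)
      rw [SimpleGraph.Walk.length_append] at h1
      have h2 := hG _ _ h _ (p.bypass_isPath.takeUntil hs)
      rw [SimpleGraph.Walk.length_cons, Nat.even_add_one, ← ih, ← h1, Nat.even_add]
      tauto
    · rw [SimpleGraph.Walk.length_cons, SimpleGraph.Walk.length_cons, Nat.even_add_one,
        Nat.even_add_one, ih]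

theorem SimpleGraph.exists_even_path_of_not_colorable_two {V : Type*} {G : SimpleGraph V}
    (hG : ¬ G.Colorable 2) :
    ∃ u v, G.Adj u v ∧ ∃ p : G.Walk v u, p.IsPath ∧ Even p.length := by
  classical
  by_contra! hcon
  refine hG (SimpleGraph.two_colorable_iff_forall_loop_even.2 fun u w => ?_)
  rw [← SimpleGraph.Walk.even_bypass_length_iff (fun u v h p hp =>
    Nat.not_even_iff_odd.2 (by simpa using hcon u v h p hp))]
  have : w.bypass = .nil := (SimpleGraph.Walk.isPath_iff_nil.1 w.bypass_isPath).eq_nil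
  rw [this]
  simp

/-- A monochromatic path of length `2 * m` inside `V` from `v` to `u`. -/
def IsEvenPath {n r : ℕ} (V : Finset (EuclideanSpace ℝ (Fin n)))
    (c : EuclideanSpace ℝ (Fin n) → Fin r)
    (ψ : EuclideanSpace ℝ (Fin n) → EuclideanSpace ℝ (Fin n)) (u v : EuclideanSpace ℝ (Fin n))
    (κ : Fin r) (m : ℕ) : Prop :=
  1 ≤ m ∧ ∃ w : ℕ → EuclideanSpace ℝ (Fin n), w 0 = v ∧ w (2 * m) = u ∧
    (∀ i ≤ 2 * m, ∀ j ≤ 2 * m, w i = w j → i = j) ∧ (∀ i, w i ∈ V) ∧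
    (∀ i < 2 * m, dist (w i) (w (i + 1)) = 1) ∧ ∀ i ≤ 2 * m, c (ψ (w i)) = κ

/-- If every color class were bipartite, refining the colors by the bipartitions would properly
color `V` with `2 * r` colors. A nonbipartite class has an odd cycle, here cut into an edge and an
even path; the label records the color and half the path length. -/
theorem exists_isEvenPath {n r : ℕ} {V : Finset (EuclideanSpace ℝ (Fin n))}
    (hV : ¬ ((unitDistanceGraph n).induce (V : Set (EuclideanSpace ℝ (Fin n)))).Colorable (2 * r))
    (c : EuclideanSpace ℝ (Fin n) → Fin r)
    (ψ : EuclideanSpace ℝ (Fin n) → EuclideanSpace ℝ (Fin n)) :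
    ∃ u ∈ V, ∃ v ∈ V, dist u v = 1 ∧ ∃ τ : Fin r × Fin V.card, IsEvenPath V c ψ u v τ.1 τ.2 := by
  let G : Fin r → SimpleGraph V := fun κ =>
    { Adj := fun u v => dist (u : EuclideanSpace ℝ (Fin n)) v = 1 ∧ c (ψ u) = κ ∧ c (ψ v) = κ
      symm := ⟨fun u v h => ⟨by rw [dist_comm]; exact h.1, h.2.2, h.2.1⟩⟩
      loopless := ⟨fun u h => by simp at h⟩ }
  obtain ⟨κ, hκ⟩ : ∃ κ, ¬ (G κ).Colorable 2 := by
    by_contra! hcon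
    have f : ∀ κ, (G κ).Coloring (Fin 2) := fun κ => Classical.choice (hcon κ)
    apply hV
    have := SimpleGraph.Coloring.colorable (α := Fin r × Fin 2)
      (G := (unitDistanceGraph n).induce (V : Set (EuclideanSpace ℝ (Fin n))))
      ⟨fun x => (c (ψ x), f (c (ψ x)) x), fun {x y} hxy heq => ?_⟩
    · simpa [mul_comm] using this
    · simp only [Prod.mk.injEq] at heq
      have hadj : (G (c (ψ x))).Adj x y := ⟨hxy, rfl, heq.1.symm⟩
      refine (f _).valid hadj ?_
      rw [heq.2, heq.1]
  obtain ⟨u, v, huv, p, hp, m, hm⟩ := SimpleGraph.exists_even_path_of_not_colorable_two hκ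
  have hlt := hp.length_lt
  rw [Fintype.card_coe] at hlt
  have hm0 : m ≠ 0 := by
    rintro rfl
    exact huv.ne (SimpleGraph.Walk.eq_of_length_eq_zero hm).symm
  have hlen : p.length = 2 * m := by omega
  refine ⟨u, u.2, v, v.2, huv.1, (κ, ⟨m, by omega⟩), by simp only; omega, fun i => p.getVert i,
    by simp, ?_, ?_, fun i => Subtype.coe_prop _, ?_, ?_⟩
  · simp only
    rw [← hlen, SimpleGraph.Walk.getVert_length]
  · intro i hi j hj hij
    simp only at hi hj
    exact hp.getVert_injOn (by simp; omega) (by simp; omega) (Subtype.ext hij)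
  · intro i hi
    simp only at hi
    exact (p.adj_getVert_succ (by omega : i < p.length)).1
  · intro i hi
    simp only at hi
    rcases Nat.lt_or_ge i p.length with h | h
    · exact (p.adj_getVert_succ h).2.1
    · obtain rfl : i = (p.length - 1) + 1 := by omega
      exact (p.adj_getVert_succ (by omega)).2.2

theorem exists_monochromatic_odd_cycle {n r : ℕ} (hn : 2 ≤ n)
    (hr : ¬ (unitDistanceGraph n).Colorable (2 * r)) :
    ∃ l₀ : ℕ, ∀ l, l₀ ≤ l → ∀ c : EuclideanSpace ℝ (Fin n) → Fin r,
      ∃ A, IsUnitCopy (SimpleGraph.cycleGraph (2 * l + 1)) A ∧ IsMonochromatic c A := by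
  obtain ⟨V, hV⟩ := exists_finite_not_colorable _ _ hr
  -- Since `m < V.card`, this keeps `l + 1 - m ≥ 6`, as the even cycles require.
  refine ⟨V.card + 5, fun l hl c => ?_⟩
  obtain ⟨ε, hε, h⟩ := exists_dense_unit_cube hn V
    (fun ψ u v (τ : Fin r × Fin V.card) => IsEvenPath V c ψ u v τ.1 τ.2)
    fun ψ _ => exists_isEvenPath hV c ψ
  choose N₀ hN₀ using fun m : Fin V.card =>
    exists_induced_cycle_of_dense (l + 1 - m) (Or.inr (by omega)) hε
  obtain ⟨⟨κ, m⟩, Φ, Sel, hinj, hadj, hpath, hdense⟩ := h (Finset.univ.sup N₀)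
  obtain ⟨g, hg, hgadj, hgd, -, hclose⟩ := hN₀ m _ Sel
    (by rw [Fintype.card_fin]; exact Finset.le_sup (Finset.mem_univ m)) hdense
  have hmV := m.2
  -- Replacing one edge of a cycle of length `L` by a path of length `2 * m` gives length `L - 1 + 2
  -- * m = 2 * l + 1`.
  obtain ⟨L, hL⟩ : ∃ L, L = 2 * (l + 1 - m.val) := ⟨_, rfl⟩
  rw [← hL] at hg hgadj hclose
  have hcolor : ∀ A B, IsDownEdge Sel A B → c (Φ A) = κ ∧ c (Φ B) = κ := by
    intro A B hAB
    obtain ⟨ψ, u, v, -, ⟨-, w, hw0, hwm, -, -, -, hwc⟩, hu, hv, -⟩ := hpath A B hAB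
    rw [← hu, ← hv, ← hw0, ← hwm]
    exact ⟨hwc _ le_rfl, hwc _ (Nat.zero_le _)⟩
  have hgc : ∀ i < L, c (Φ (g i)) = κ := by
    intro i hi
    rcases Nat.even_or_odd' i with ⟨j, rfl | rfl⟩
    · exact (hcolor _ _ (hgd j (by omega))).1
    · exact (hcolor _ _ (hgd j (by omega))).2
  obtain ⟨ψ, u, v, hψ, ⟨hm1, w, hw0, hwm, hwinj, hwV, hwd, hwc⟩, hu, hv, hψV⟩ :=
    hpath _ _ hclose
  simp only at hm1 hwm hwinj hwd hwc
  have hcross : ∀ i < L, ∀ j, 1 ≤ j → j < 2 * m.val → Φ (g i) ≠ ψ (w j) := by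
    intro i hi j hj1 hj2 heq
    rcases hψV _ (hwV j) _ heq.symm with h | h
    · rw [h, ← hu, ← hwm] at heq
      have := hwinj _ le_rfl _ hj2.le (hψ.injective heq)
      omega
    · rw [h, ← hv, ← hw0] at heq
      have := hwinj _ (Nat.zero_le _) _ hj2.le (hψ.injective heq)
      omega
  -- The cube cycle is traversed from `g 0` to `g (L - 1)`, then the interior of the path; the shift
  -- `+ 1` skips `w 0`, whose image is already `Φ (g (L - 1))`.
  let f : ℕ → EuclideanSpace ℝ (Fin n) := fun i => if i < L then Φ (g i) else ψ (w (i - L + 1))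
  have hf1 : ∀ i < L, f i = Φ (g i) := fun i hi => if_pos hi
  have hf2 : ∀ i, L ≤ i → f i = ψ (w (i - L + 1)) := fun i hi => if_neg (not_lt.2 hi)
  have hfinj : ∀ i < 2 * l + 1, ∀ j < 2 * l + 1, f i = f j → i = j := by
    intro i hi j hj hij
    rcases lt_or_ge i L with h1 | h1 <;> rcases lt_or_ge j L with h2 | h2
    · rw [hf1 i h1, hf1 j h2] at hij
      exact hg i h1 j h2 (hinj hij)
    · rw [hf1 i h1, hf2 j h2] at hij
      exact absurd hij (hcross i h1 _ (by omega) (by omega))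
    · rw [hf2 i h1, hf1 j h2] at hij
      exact absurd hij.symm (hcross j h2 _ (by omega) (by omega))
    · rw [hf2 i h1, hf2 j h2] at hij
      have := hwinj _ (by omega) _ (by omega) (hψ.injective hij)
      omega
  have hstep : ∀ i, i + 1 < 2 * l + 1 → dist (f i) (f (i + 1)) = 1 := by
    intro i hi
    rcases lt_trichotomy (i + 1) L with h1 | h1 | h1
    · rw [hf1 i (by omega), hf1 _ h1, ← hadj, SimpleGraph.hasse_adj,
        hgadj i (by omega) _ h1]
      exact Or.inl rfl
    · rw [hf1 i (by omega), hf2 _ h1.ge, show g i = g (L - 1) by rw [← h1]; rfl, ← hv, ← hw0,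
        hψ.dist_eq, h1, Nat.sub_self]
      exact hwd 0 (by omega)
    · rw [hf2 i (by omega), hf2 _ h1.le, hψ.dist_eq,
        show i + 1 - L + 1 = (i - L + 1) + 1 by omega]
      exact hwd _ (by omega)
  have hlast : dist (f (2 * l)) (f 0) = 1 := by
    rw [hf1 0 (by omega), hf2 _ (by omega), ← hu, ← hwm, hψ.dist_eq]
    have := hwd (2 * l - L + 1) (by omega)
    rwa [show 2 * l - L + 1 + 1 = 2 * m.val by omega] at this
  refine ⟨Set.range fun i : Fin (2 * l + 1) => f i, ⟨fun i => f i, fun i j hij =>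
    Fin.ext (hfinj i i.2 j j.2 hij), rfl, fun a b hab => ?_⟩, κ, ?_⟩
  · rw [cycleGraph_adj_iff_cycAdj (by omega)] at hab
    have ha := a.2
    have hb := b.2
    dsimp only
    rcases hab with h | h | ⟨h, h'⟩ | ⟨h, h'⟩
    · rw [← h]; exact hstep _ (by omega)
    · rw [← h, dist_comm]; exact hstep _ (by omega)
    · rw [dist_comm, h, show b.val = 2 * l by omega]; exact hlast
    · rw [h, show a.val = 2 * l by omega]; exact hlast
  · rintro _ ⟨i, rfl⟩
    have hi := i.2
    dsimp only
    rcases lt_or_ge i.val L with h1 | h1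
    · rw [hf1 _ h1]; exact hgc _ h1
    · rw [hf2 _ h1]; exact hwc _ (by omega)

theorem natCeil_half (k : ℕ) : ⌈(k : ℝ) / 2⌉₊ = (k + 1) / 2 := by
  apply le_antisymm
  · rw [Nat.ceil_le, div_le_iff₀ (by norm_num)]
    have : k ≤ (k + 1) / 2 * 2 := by omega
    exact_mod_cast this
  · have h := Nat.le_ceil ((k : ℝ) / 2)
    rw [div_le_iff₀ (by norm_num)] at h
    have : k ≤ ⌈(k : ℝ) / 2⌉₊ * 2 := by exact_mod_cast h
    omega

/-- Colors are merged in pairs by halving; inside a merged class the parity of the old color is a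
proper 2-coloring, impossible on an odd cycle. -/
theorem exists_coloring_half_no_odd_cycle {n k : ℕ} (hk : (unitDistanceGraph n).Colorable k)
    {l : ℕ} (hl : 1 ≤ l) : ∃ c : EuclideanSpace ℝ (Fin n) → Fin ((k + 1) / 2),
      ∀ A, IsUnitCopy (SimpleGraph.cycleGraph (2 * l + 1)) A → ¬ IsMonochromatic c A := by
  obtain ⟨c⟩ := hk
  refine ⟨fun x => ⟨(c x).val / 2, by have := (c x).2; omega⟩, ?_⟩
  rintro A ⟨f, -, rfl, hadj⟩ ⟨κ, hκ⟩
  have hcol : (SimpleGraph.cycleGraph (2 * l + 1)).Colorable 2 := by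
    refine ⟨⟨fun v => ⟨(c (f v)).val % 2, Nat.mod_lt _ (by norm_num)⟩, fun {u v} huv heq => ?_⟩⟩
    have h1 : (unitDistanceGraph n).Adj (f u) (f v) := hadj u v huv
    refine c.valid h1 (Fin.ext ?_)
    have hu := congrArg Fin.val (hκ _ ⟨u, rfl⟩)
    have hv := congrArg Fin.val (hκ _ ⟨v, rfl⟩)
    have he := congrArg Fin.val heq
    simp only at hu hv he
    omega
  have h3 := SimpleGraph.chromaticNumber_cycleGraph_of_odd (2 * l + 1) (by omega) ⟨l, rfl⟩
  have h2 := SimpleGraph.chromaticNumber_le_iff_colorable.2 hcol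
  rw [h3] at h2
  norm_num at h2

/-! ### Assembly -/

theorem theorem1p1 (n : ℕ) (hn : 2 ≤ n) :
    -- `χ(ℝⁿ)` is a natural number `k`
    ∃ k : ℕ, chiSpace n = (k : ℕ∞) ∧
      -- (1) forests (finite, with at least one edge)
      (∀ (V : Type*) [Finite V] (F : SimpleGraph V), F.IsAcyclic → F ≠ ⊥ →
        chiGraphInd n F = (k : ℕ∞) ∧ chiGraph n F = (k : ℕ∞)) ∧
      -- (2) even cycles
      (∀ l : ℕ, l = 4 ∨ 6 ≤ l →
        chiGraphInd n (SimpleGraph.cycleGraph (2 * l)) = (k : ℕ∞) ∧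
        chiGraph n (SimpleGraph.cycleGraph (2 * l)) = (k : ℕ∞)) ∧
      -- (3) long odd cycles
      (∃ l₀ : ℕ, ∀ l : ℕ, l₀ ≤ l →
        chiGraph n (SimpleGraph.cycleGraph (2 * l + 1)) = ((⌈(k : ℝ) / 2⌉₊ : ℕ) : ℕ∞)) := by
  obtain ⟨k, hchi, hk, hlt⟩ := chiSpace_eq_natCast n
  refine ⟨k, hchi, fun V _ F hF hne => ?_, fun l hl => ?_, ?_⟩
  · exact chiGraph_eq_of_forall_lt hne hk fun r hr c =>
      exists_monochromatic_induced_forest hn (hlt r hr) c hF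
  · exact chiGraph_eq_of_forall_lt (cycleGraph_ne_bot (by omega)) hk fun r hr c =>
      exists_monochromatic_induced_even_cycle hn (hlt r hr) c hl
  · choose! l₀ hl₀ using fun r (hr : 2 * r < k) => exists_monochromatic_odd_cycle hn (hlt _ hr)
    -- The supremum covers every `r` with `2 * r < k`, and the added one ensures `l ≥ 1`, so that
    -- the graph is a genuine odd cycle.
    refine ⟨(Finset.range k).sup l₀ + 1, fun l hl => ?_⟩
    rw [natCeil_half]
    refine iInf_natCast_eq (exists_coloring_half_no_odd_cycle hk (by omega)) ?_
    rintro r ⟨c, hc⟩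
    by_contra! hr
    have hle : l₀ r ≤ (Finset.range k).sup l₀ :=
      Finset.le_sup (f := l₀) (Finset.mem_range.2 (by omega))
    obtain ⟨A, h1, h2⟩ := hl₀ r (by omega) l (by omega) c
    exact hc A h1 h2
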